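/- Let $\mathbf{Bicat}$ be the category of small bicategories and normal pseudofunctors, i.e. pseudofunctors that preserve identity morphisms strictly (and compositions up to specified coherent invertible 2-cells). For $n \ge 0$ and $m_1,\dots,m_n \ge 0$ let $[n;m_1,\dots,m_n]$ be the 2-category freely generated by the 2-dimensional globular pasting diagram of length $n$ and widths $m_1,\dots,m_n$: its objects are $0,\dots,n$, its hom-category from $i$ to $j$ is the product of ordinals $[m_{i+1}] \times \cdots \times [m_j]$ if $i \le j$ and is empty otherwise, and composition is concatenation; its degree is $n + m_1 + \cdots + m_n$. Let $\Theta_2$ be the full subcategory of the category of small 2-categories and strict 2-functors on these objects, and let $i_b \colon \Theta_b \hookrightarrow \Theta_2$ be the subcategory whose objects are those of degree $\le 3$ and whose morphisms are generated under composition by all morphisms of $\Theta_2$ between objects of degree $\le 2$ together with all monomorphisms of $\Theta_2$ from an object of degree $2$ to an object of degree $3$. The coherent nerve functor $N \colon \mathbf{Bicat} \to [\Theta_2^{\mathrm{op}},\mathbf{Set}]$ is the singular functor $B \mapsto \mathbf{Bicat}(-,B)$ of the inclusion $\Theta_2 \to \mathbf{Bicat}$, and the truncated coherent nerve functor $N_b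 \colon \mathbf{Bicat} \to [\Theta_b^{\mathrm{op}},\mathbf{Set}]$ is the singular functor of the composite inclusion $\Theta_b \to \Theta_2 \to \mathbf{Bicat}$. Theorem. The functor $N$ is fully faithful; the functor $N_b$ is fully faithful; and $N$ is isomorphic to the composite $$\mathbf{Bicat} \xrightarrow{\;N_b\;} [\Theta_b^{\mathrm{op}},\mathbf{Set}] \xrightarrow{\;(i_b)_*\;} [\Theta_2^{\mathrm{op}},\mathbf{Set}],$$ where $(i_b)_*$ is right Kan extension along $i_b^{\mathrm{op}}$. -/

import Mathlib

open CategoryTheory Bicategory Opposite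

universe w v u

/-! ### The category of bicategories and normal pseudofunctors -/

/-- Two normal pseudofunctors with the same action on objects, morphisms and 2-cells and with the
same constraints are equal. -/
theorem normalPseudofunctor_ext {A : Type*} [Bicategory A] {B : Type*} [Bicategory B]
    {F G : StrictlyUnitaryPseudofunctor A B}
    (h : F.toPrelaxFunctor = G.toPrelaxFunctor)
    (hId : ∀ a, HEq (F.mapId a) (G.mapId a))
    (hComp : ∀ {a b c : A} (f : a ⟶ b) (g : b ⟶ c), HEq (F.mapComp f g) (G.mapComp f g)) :
    F = G := by
  obtain ⟨⟨F₀, F₁, F₂, _, _, _, _, _⟩, _, _⟩ := F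
  obtain ⟨⟨G₀, G₁, G₂, _, _, _, _, _⟩, _, _⟩ := G
  dsimp only at h
  subst h
  obtain rfl : F₁ = G₁ := by
    funext a
    exact eq_of_heq (hId a)
  obtain rfl : @F₂ = @G₂ := by
    funext a b c f g
    exact eq_of_heq (hComp f g)
  rfl

/-- A small bicategory. -/
structure Bicat : Type (max (u + 1) (v + 1) (w + 1)) where
  carrier : Type u
  [str : Bicategory.{w, v} carrier]

attribute [instance] Bicat.str

/-- The category of bicategories and normal pseudofunctors. -/
instance Bicat.category : Category.{max w v u} Bicat.{w, v, u} where
  Hom A B := StrictlyUnitaryPseudofunctor A.carrier B.carrier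
  id A := StrictlyUnitaryPseudofunctor.id A.carrier
  comp F G := StrictlyUnitaryPseudofunctor.comp F G
  id_comp F := normalPseudofunctor_ext rfl
    (fun a => heq_of_eq (Iso.ext (by
      change F.map₂ (𝟙 _) ≫ (F.mapId a).hom = _
      rw [F.map₂_id, Category.id_comp])))
    (fun f g => heq_of_eq (Iso.ext (by
      change F.map₂ (𝟙 _) ≫ (F.mapComp f g).hom = _
      rw [F.map₂_id, Category.id_comp])))
  comp_id F := normalPseudofunctor_ext rfl
    (fun a => heq_of_eq (Iso.ext (Category.comp_id (F.mapId a).hom)))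
    (fun f g => heq_of_eq (Iso.ext (Category.comp_id (F.mapComp f g).hom)))
  assoc F G H := normalPseudofunctor_ext rfl
    (fun a => heq_of_eq (Iso.ext (by
      change H.map₂ (G.map₂ (F.mapId a).hom ≫ (G.mapId (F.obj a)).hom) ≫
          (H.mapId (G.obj (F.obj a))).hom =
        H.map₂ (G.map₂ (F.mapId a).hom) ≫ H.map₂ (G.mapId (F.obj a)).hom ≫
          (H.mapId (G.obj (F.obj a))).hom
      rw [H.map₂_comp, Category.assoc])))
    (fun f g => heq_of_eq (Iso.ext (by
      change H.map₂ (G.map₂ (F.mapComp f g).hom ≫ (G.mapComp (F.map f) (F.map g)).hom) ≫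
          (H.mapComp (G.map (F.map f)) (G.map (F.map g))).hom =
        H.map₂ (G.map₂ (F.mapComp f g).hom) ≫ H.map₂ (G.mapComp (F.map f) (F.map g)).hom ≫
          (H.mapComp (G.map (F.map f)) (G.map (F.map g))).hom
      rw [H.map₂_comp, Category.assoc])))

/-! ### The category of 2-categories and 2-functors -/

/-- A small (strict) 2-category. -/
structure TwoCat : Type (max (u + 1) (v + 1) (w + 1)) where
  carrier : Type u
  [str : Bicategory.{w, v} carrier]
  [strict : Bicategory.Strict carrier]

attribute [instance] TwoCat.str TwoCat.strict

theorem strictPseudofunctor_ext {A : Type*} [Bicategory A] {B : Type*} [Bicategory B]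
    {F G : StrictPseudofunctor A B}
    (h : F.toStrictlyUnitaryPseudofunctor = G.toStrictlyUnitaryPseudofunctor) : F = G := by
  cases F
  cases G
  dsimp only at h
  subst h
  rfl

/-- The category of 2-categories and (strict) 2-functors. -/
instance TwoCat.category : Category.{max w v u} TwoCat.{w, v, u} where
  Hom A B := StrictPseudofunctor A.carrier B.carrier
  id A := StrictPseudofunctor.id A.carrier
  comp F G := StrictPseudofunctor.comp F G
  id_comp {A B} F := strictPseudofunctor_ext
    (Category.id_comp (X := Bicat.mk A.carrier) (Y := Bicat.mk B.carrier)
      F.toStrictlyUnitaryPseudofunctor)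
  comp_id {A B} F := strictPseudofunctor_ext
    (Category.comp_id (X := Bicat.mk A.carrier) (Y := Bicat.mk B.carrier)
      F.toStrictlyUnitaryPseudofunctor)
  assoc {A B C D} F G H := strictPseudofunctor_ext
    (Category.assoc (W := Bicat.mk A.carrier) (X := Bicat.mk B.carrier)
      (Y := Bicat.mk C.carrier) (Z := Bicat.mk D.carrier)
      F.toStrictlyUnitaryPseudofunctor G.toStrictlyUnitaryPseudofunctor
      H.toStrictlyUnitaryPseudofunctor)

/-- The inclusion of the category of 2-categories and 2-functors into the category of
bicategories and normal pseudofunctors. -/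
def TwoCat.toBicat : TwoCat.{w, v, u} ⥤ Bicat.{w, v, u} where
  obj A := Bicat.mk A.carrier
  map F := F.toStrictlyUnitaryPseudofunctor
  map_id _ := rfl
  map_comp _ _ := rfl

/-! ### The 2-categories `[n; m₁, …, mₙ]` -/

/-- A 2-dimensional globular pasting diagram `(n; m₁, …, mₙ)`: its length `n` and its widths.
The width `m k`, for `k : Fin n`, is the one of the hom-graph from `k` to `k + 1`. -/
structure PastingDiagram : Type where
  n : ℕ
  m : Fin n → ℕ

namespace PastingDiagram

variable (θ : PastingDiagram)

/-- The objects `0, …, n` of `[n; m₁, …, mₙ]`. -/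
@[ext]
structure Obj : Type u where
  idx : Fin (θ.n + 1)

variable {θ}

/-- The morphisms from `i` to `j` in `[n; m₁, …, mₙ]`: there is none unless `i ≤ j`, and then they
are the elements of the product of the ordinals `{0 < ⋯ < m k}`, over the `k` with
`i ≤ k < j` (where `k` stands for the elementary step from `k` to `k + 1`). -/
structure Mor (i j : Obj.{u} θ) : Type v where
  le : i.idx ≤ j.idx
  val : ∀ k : Fin θ.n, i.idx ≤ k.castSucc → k.castSucc < j.idx → Fin (θ.m k + 1)

@[ext]
theorem Mor.ext {i j : Obj.{u} θ} {f g : Mor.{v, u} i j}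
    (h : ∀ k h₁ h₂, f.val k h₁ h₂ = g.val k h₁ h₂) : f = g := by
  obtain ⟨_, f⟩ := f
  obtain ⟨_, g⟩ := g
  obtain rfl : f = g := by
    funext k h₁ h₂
    exact h k h₁ h₂
  rfl

/-- The 2-cells of `[n; m₁, …, mₙ]`: the hom-categories are products of ordinals, so that there is
at most one 2-cell from `f` to `g`, and there is one when `f ≤ g` in each coordinate. -/
structure Cell {i j : Obj.{u} θ} (f g : Mor.{v, u} i j) : Type w where
  le : ∀ k h₁ h₂, f.val k h₁ h₂ ≤ g.val k h₁ h₂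

instance cell_subsingleton {i j : Obj.{u} θ} (f g : Mor.{v, u} i j) :
    Subsingleton (Cell.{w, v, u} f g) where
  allEq := by
    rintro ⟨_⟩ ⟨_⟩
    rfl

instance homCategory (i j : Obj.{u} θ) : Category.{w} (Mor.{v, u} i j) where
  Hom f g := Cell.{w, v, u} f g
  id f := ⟨fun _ _ _ => le_rfl⟩
  comp η μ := ⟨fun k h₁ h₂ => (η.le k h₁ h₂).trans (μ.le k h₁ h₂)⟩

instance hom_subsingleton {i j : Obj.{u} θ} (f g : Mor.{v, u} i j) :
    Subsingleton (Quiver.Hom.{w} f g) :=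
  cell_subsingleton.{w, v, u} f g

instance categoryStruct : CategoryStruct.{v} (Obj.{u} θ) where
  Hom i j := Mor.{v, u} i j
  id _ := ⟨le_rfl, fun _ h₁ h₂ => absurd h₂ (not_lt.2 h₁)⟩
  comp {_ j _} f g := ⟨Mor.le f |>.trans (Mor.le g), fun k h₁ h₂ =>
    if h : k.castSucc < j.idx then f.val k h₁ h else g.val k (not_lt.1 h) h₂⟩

theorem id_comp' {i j : Obj.{u} θ} (f : Quiver.Hom.{v} i j) : 𝟙 i ≫ f = f := by
  refine Mor.ext fun k h₁ h₂ => ?_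
  exact dif_neg (not_lt.2 h₁)

theorem comp_id' {i j : Obj.{u} θ} (f : Quiver.Hom.{v} i j) : f ≫ 𝟙 j = f := by
  refine Mor.ext fun k h₁ h₂ => ?_
  exact dif_pos h₂

theorem assoc' {i j k l : Obj.{u} θ} (f : Quiver.Hom.{v} i j) (g : Quiver.Hom.{v} j k)
    (h : Quiver.Hom.{v} k l) : (f ≫ g) ≫ h = f ≫ g ≫ h := by
  refine Mor.ext fun a h₁ h₂ => ?_
  have hjk : j.idx ≤ k.idx := Mor.le g
  simp only [CategoryStruct.comp]
  split_ifs with h₃ h₄ h₅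
  · rfl
  · rfl
  · exact absurd (h₅.trans_le hjk) h₃
  · rfl

/-- The 2-category structure on `[n; m₁, …, mₙ]`. -/
instance bicategory : Bicategory.{w, v} (Obj.{u} θ) where
  homCategory i j := homCategory i j
  whiskerLeft {_ j _} f _ _ η := ⟨fun k h₁ h₂ => by
    simp only [CategoryStruct.comp]
    split_ifs with h
    · exact le_rfl
    · exact Cell.le η k (not_lt.1 h) h₂⟩
  whiskerRight {_ j _} _ _ η g := ⟨fun k h₁ h₂ => by
    simp only [CategoryStruct.comp]
    split_ifs with h
    · exact Cell.le η k h₁ h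
    · exact le_rfl⟩
  associator f g h := @eqToIso _ (homCategory _ _) _ _ (assoc' f g h)
  leftUnitor f := @eqToIso _ (homCategory _ _) _ _ (id_comp' f)
  rightUnitor f := @eqToIso _ (homCategory _ _) _ _ (comp_id' f)
  whiskerLeft_id _ _ := (hom_subsingleton _ _).elim _ _
  whiskerLeft_comp _ _ _ _ _ _ := (hom_subsingleton _ _).elim _ _
  id_whiskerLeft _ := (hom_subsingleton _ _).elim _ _
  comp_whiskerLeft _ _ _ _ _ := (hom_subsingleton _ _).elim _ _
  id_whiskerRight _ _ := (hom_subsingleton _ _).elim _ _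
  comp_whiskerRight _ _ _ := (hom_subsingleton _ _).elim _ _
  whiskerRight_id _ := (hom_subsingleton _ _).elim _ _
  whiskerRight_comp _ _ _ := (hom_subsingleton _ _).elim _ _
  whisker_assoc _ _ _ _ _ := (hom_subsingleton _ _).elim _ _
  whisker_exchange _ _ := (hom_subsingleton _ _).elim _ _
  pentagon _ _ _ _ := (hom_subsingleton _ _).elim _ _
  triangle _ _ := (hom_subsingleton _ _).elim _ _

instance strict : Bicategory.Strict.{w, v} (Obj.{u} θ) where
  id_comp := id_comp'
  comp_id := comp_id'
  assoc := assoc'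
  leftUnitor_eqToIso _ := rfl
  rightUnitor_eqToIso _ := rfl
  associator_eqToIso _ _ _ := rfl

variable (θ)

/-- The 2-category `[n; m₁, …, mₙ]`. -/
def twoCat : TwoCat.{w, v, u} where
  carrier := Obj.{u} θ

/-- The degree `n + m₁ + ⋯ + mₙ`. -/
def degree : ℕ := θ.n + ∑ k, θ.m k

end PastingDiagram

/-! ### The category `Θ₂` and the coherent nerve -/

/-- Joyal's category `Θ₂`: the full subcategory of the category of 2-categories and 2-functors
whose objects are the 2-categories `[n; m₁, …, mₙ]`. -/
abbrev Theta₂ : Type := InducedCategory TwoCat.{w, v, u} PastingDiagram.twoCat.{w, v, u}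

/-- The degree of an object of `Θ₂`. -/
def Theta₂.degree (x : Theta₂.{w, v, u}) : ℕ := PastingDiagram.degree x

/-- The inclusion of `Θ₂` into the category of bicategories and normal pseudofunctors. -/
def Theta₂.toBicat : Theta₂.{w, v, u} ⥤ Bicat.{w, v, u} :=
  inducedFunctor PastingDiagram.twoCat.{w, v, u} ⋙ TwoCat.toBicat

/-- The singular functor of `K : A ⥤ C`: it sends `X` to the presheaf `C(K -, X)` on `A`. -/
abbrev singularFunctor {A : Type*} [Category* A] {C : Type*} [Category.{v} C] (K : A ⥤ C) :
    C ⥤ Aᵒᵖ ⥤ Type v :=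
  yoneda ⋙ (Functor.whiskeringLeft _ _ _).obj K.op

/-- The coherent nerve functor. -/
abbrev coherentNerve : Bicat.{w, v, u} ⥤ Theta₂.{w, v, u}ᵒᵖ ⥤ Type (max w v u) :=
  singularFunctor Theta₂.toBicat

/-! ### The subcategory `Θ_b` and the truncated coherent nerve -/

/-- The property of an object of `Θ₂` of having degree at most three. -/
def degreeLEThree : ObjectProperty Theta₂.{w, v, u} := fun x => x.degree ≤ 3

/-- The morphisms that generate `Θ_b`: all the morphisms between objects of degree at most two, and
the monomorphisms of `Θ₂` from an object of degree two to an object of degree three. -/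
def thetaBGenerators : MorphismProperty degreeLEThree.{w, v, u}.FullSubcategory := fun x y f =>
  (x.obj.degree ≤ 2 ∧ y.obj.degree ≤ 2) ∨
    (x.obj.degree = 2 ∧ y.obj.degree = 3 ∧ Mono f.hom)

/-- The subcategory `Θ_b` of `Θ₂`: its objects are those of degree at most three, its morphisms are
the composites of (finitely many) generating morphisms. -/
abbrev ThetaB : Type := WideSubcategory thetaBGenerators.{w, v, u}.multiplicativeClosure

/-- The inclusion of `Θ_b` into `Θ₂`. -/
def ThetaB.incl : ThetaB.{w, v, u} ⥤ Theta₂.{w, v, u} :=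
  wideSubcategoryInclusion _ ⋙ degreeLEThree.ι

/-- The truncated coherent nerve functor. -/
abbrev truncatedNerve : Bicat.{w, v, u} ⥤ ThetaB.{w, v, u}ᵒᵖ ⥤ Type (max w v u) :=
  singularFunctor (ThetaB.incl ⋙ Theta₂.toBicat)

-- On the shapes `[0]`, `[1; 0]`, `[1; 1]` and `[2; 0, 0]`, all of degree at most two, the nerve of
-- a bicategory `A` consists of its objects, morphisms, 2-cells and triangles `σ : h ≅ f ≫ g`. These
-- determine a normal pseudofunctor (`NerveMap.ext_of_comp_eq`), which gives faithfulness. A map of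
-- truncated nerves proposes an action on objects, morphisms and 2-cells, and a compositor, namely
-- the image of the triangle with `σ` the identity. The axioms are read off from the shapes of
-- degree three: `[1; 2]` gives vertical functoriality, `[2; 1, 0]` and `[2; 0, 1]` compatibility
-- with whiskering, `[3; 0, 0, 0]` associativity. The shape `[2; 1, 0]` also reduces a general
-- triangle to the one with identity `σ` (`NerveMap.compositor_hom`); the unit laws are transported
-- from `[1; 0]`. The given map is then postcomposition with the pseudofunctor so obtained
-- (`NerveMap.app_eq`), which gives fullness.
--
-- The delicate point is naturality: the generators of `Θ_b` reach degree three only by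
-- monomorphisms from degree two. Nondegenerate 2-cells and composable pairs are of this kind.
-- Arrows and points in an object of degree three are faces of these, and degenerate cells factor
-- through smaller shapes; hence naturality holds for all the test maps (the lemmas `natAt_*`).
--
-- The Kan extension uses the same reconstruction, with `A` a pasting 2-category `θ` and only the
-- elements that are 2-functors; the parameter `Q` is `False` for the full nerve and `True` for this
-- variant. Given a presheaf `G` on `Θ₂`, a map `β` from its restriction to the truncated nerve of
-- `B`, and `g` in `G(θ)`, the family sending `s : ρ ⟶ θ` to `β (G(s) g)` is natural, hence is
-- induced by a normal pseudofunctor from `θ` to `B`. This extends `β` uniquely to a map from `G` to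
-- the nerve of `B`. The nerve is thus the right Kan extension of its restriction, and its full
-- faithfulness follows from that of the truncated nerve.

universe w₁ v₁ u₁ w₂ v₂ u₂

/-! ### Normal pseudofunctors out of a pasting 2-category -/

namespace PastingDiagram

/-- The type of objects of the 2-category `[n; m₁, …, mₙ]`. -/
abbrev Carrier (θ : PastingDiagram) : Type u := (twoCat.{w, v, u} θ).carrier

variable {θ : PastingDiagram}

/-- The index of an object of `[n; m₁, …, mₙ]`. -/
abbrev ix (i : Carrier.{w, v, u} θ) : Fin (θ.n + 1) := Obj.idx i

theorem ix_ext {i j : Carrier.{w, v, u} θ} (h : ix i = ix j) : i = j := Obj.ext h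

theorem ix_le {i j : Carrier.{w, v, u} θ} (f : i ⟶ j) : ix i ≤ ix j := Mor.le f

instance cells_subsingleton {i j : Carrier.{w, v, u} θ} (f g : i ⟶ j) : Subsingleton (f ⟶ g) :=
  hom_subsingleton.{w, v, u} f g

instance endo_subsingleton (i : Carrier.{w, v, u} θ) : Subsingleton (i ⟶ i) where
  allEq _ _ := Mor.ext fun _ h₁ h₂ => absurd h₂ (not_lt.2 h₁)

theorem endo_eq_id {i : Carrier.{w, v, u} θ} (f : i ⟶ i) : f = 𝟙 i := Subsingleton.elim _ _

/-- The order relation on the objects of `[n; m₁, …, mₙ]`, as an inductive family that separates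
equality from strict inequality. -/
inductive Rel : Carrier.{w, v, u} θ → Carrier.{w, v, u} θ → Type u
  | eq (i : Carrier.{w, v, u} θ) : Rel i i
  | lt {i j : Carrier.{w, v, u} θ} (h : ix i < ix j) : Rel i j

instance Rel.subsingleton {i j : Carrier.{w, v, u} θ} : Subsingleton (Rel i j) where
  allEq r s := by
    cases r with
    | eq =>
      cases s with
      | eq => rfl
      | lt h => exact absurd h (lt_irrefl _)
    | lt h =>
      cases s with
      | eq => exact absurd h (lt_irrefl _)
      | lt h => rfl

/-- The element of `Rel i j` when there is a morphism from `i` to `j`. -/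
def Rel.of {i j : Carrier.{w, v, u} θ} (h : ix i ≤ ix j) : Rel i j :=
  if e : ix i = ix j then (ix_ext e : i = j) ▸ Rel.eq i else Rel.lt (lt_of_le_of_ne h e)

def Rel.trans : ∀ {i j k : Carrier.{w, v, u} θ}, Rel i j → Rel j k → Rel i k
  | _, _, _, .eq _, s => s
  | _, _, _, .lt h, .eq _ => .lt h
  | _, _, _, .lt h, .lt h' => .lt (h.trans h')

/-- The data of a normal pseudofunctor from `[n; m₁, …, mₙ]` to a bicategory, on the morphisms that
are not endomorphisms. -/
structure CellData (θ : PastingDiagram) (A : Type u) [Bicategory.{w, v} A] where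
  obj : Carrier.{w, v, u} θ → A
  map {i j : Carrier.{w, v, u} θ} (h : ix i < ix j) (f : i ⟶ j) : obj i ⟶ obj j
  map₂ {i j : Carrier.{w, v, u} θ} (h : ix i < ix j) {f g : i ⟶ j} (η : f ⟶ g) : map h f ⟶ map h g
  map₂_id {i j : Carrier.{w, v, u} θ} (h : ix i < ix j) (f : i ⟶ j) : map₂ h (𝟙 f) = 𝟙 _
  map₂_comp {i j : Carrier.{w, v, u} θ} (h : ix i < ix j) {f g k : i ⟶ j}
    (η : f ⟶ g) (μ : g ⟶ k) : map₂ h (η ≫ μ) = map₂ h η ≫ map₂ h μ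
  mapComp {i j k : Carrier.{w, v, u} θ} (hij : ix i < ix j) (hjk : ix j < ix k)
    (f : i ⟶ j) (g : j ⟶ k) : map (hij.trans hjk) (f ≫ g) ≅ map hij f ≫ map hjk g
  map₂_whisker_left {i j k : Carrier.{w, v, u} θ} (hij : ix i < ix j) (hjk : ix j < ix k)
    (f : i ⟶ j) {g g' : j ⟶ k} (η : g ⟶ g') :
    map₂ (hij.trans hjk) (f ◁ η) =
      (mapComp hij hjk f g).hom ≫ map hij f ◁ map₂ hjk η ≫ (mapComp hij hjk f g').inv
  map₂_whisker_right {i j k : Carrier.{w, v, u} θ} (hij : ix i < ix j) (hjk : ix j < ix k)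
    {f f' : i ⟶ j} (η : f ⟶ f') (g : j ⟶ k) :
    map₂ (hij.trans hjk) (η ▷ g) =
      (mapComp hij hjk f g).hom ≫ map₂ hij η ▷ map hjk g ≫ (mapComp hij hjk f' g).inv
  map₂_associator {i j k l : Carrier.{w, v, u} θ} (hij : ix i < ix j) (hjk : ix j < ix k)
    (hkl : ix k < ix l) (f : i ⟶ j) (g : j ⟶ k) (h : k ⟶ l) :
    map₂ (hij.trans (hjk.trans hkl)) (α_ f g h).hom =
      (mapComp (hij.trans hjk) hkl (f ≫ g) h).hom ≫ (mapComp hij hjk f g).hom ▷ map hkl h ≫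
        (α_ (map hij f) (map hjk g) (map hkl h)).hom ≫ map hij f ◁ (mapComp hjk hkl g h).inv ≫
          (mapComp hij (hjk.trans hkl) f (g ≫ h)).inv

namespace CellData

variable {A : Type u} [Bicategory.{w, v} A] (D : CellData.{w, v, u} θ A)

def mapRel : ∀ {i j : Carrier.{w, v, u} θ}, Rel i j → (i ⟶ j) → (D.obj i ⟶ D.obj j)
  | _, _, .eq _, _ => 𝟙 _
  | _, _, .lt h, f => D.map h f

def map₂Rel : ∀ {i j : Carrier.{w, v, u} θ} (r : Rel i j) {f g : i ⟶ j},
    (f ⟶ g) → (D.mapRel r f ⟶ D.mapRel r g)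
  | _, _, .eq _, _, _, _ => 𝟙 _
  | _, _, .lt h, _, _, η => D.map₂ h η

theorem map₂Rel_id {i j : Carrier.{w, v, u} θ} (r : Rel i j) (f : i ⟶ j) :
    D.map₂Rel r (𝟙 f) = 𝟙 _ := by
  cases r with
  | eq => rfl
  | lt h => exact D.map₂_id h f

theorem map₂Rel_comp {i j : Carrier.{w, v, u} θ} (r : Rel i j) {f g k : i ⟶ j}
    (η : f ⟶ g) (μ : g ⟶ k) : D.map₂Rel r (η ≫ μ) = D.map₂Rel r η ≫ D.map₂Rel r μ := by
  cases r with
  | eq => exact (Category.comp_id _).symm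
  | lt h => exact D.map₂_comp h η μ

/-- The action on an invertible 2-cell. -/
@[simps]
def map₂Iso {i j : Carrier.{w, v, u} θ} (h : ix i < ix j) {f g : i ⟶ j} (e : f ≅ g) :
    D.map h f ≅ D.map h g where
  hom := D.map₂ h e.hom
  inv := D.map₂ h e.inv
  hom_inv_id := by rw [← D.map₂_comp, e.hom_inv_id, D.map₂_id]
  inv_hom_id := by rw [← D.map₂_comp, e.inv_hom_id, D.map₂_id]

/-- Normality leaves no choice: when a factor is an identity, the constraint is an inverse unitor,
preceded by the image of the strict unit equation if the other factor is not an endomorphism. -/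
def mapCompRel : ∀ {i j k : Carrier.{w, v, u} θ} (r : Rel i j) (s : Rel j k) (t : Rel i k)
    (f : i ⟶ j) (g : j ⟶ k), D.mapRel t (f ≫ g) ≅ D.mapRel r f ≫ D.mapRel s g
  | _, _, _, .eq _, .eq _, .eq _, _, _ => (λ_ _).symm
  | _, _, _, .eq _, .eq _, .lt h, _, _ => absurd h (lt_irrefl _)
  | _, _, _, .eq _, .lt h, .eq _, _, _ => absurd h (lt_irrefl _)
  | _, _, _, .lt h, .eq _, .eq _, _, _ => absurd h (lt_irrefl _)
  | _, _, _, .eq _, .lt _, .lt h', f, g =>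
      D.map₂Iso h' (eqToIso (by rw [endo_eq_id f, Strict.id_comp])) ≪≫ (λ_ _).symm
  | _, _, _, .lt _, .eq _, .lt h', f, g =>
      D.map₂Iso h' (eqToIso (by rw [endo_eq_id g, Strict.comp_id])) ≪≫ (ρ_ _).symm
  | _, _, _, .lt h, .lt h', .eq _, _, _ => absurd (h.trans h') (lt_irrefl _)
  | _, _, _, .lt h, .lt h', .lt _, f, g => D.mapComp h h' f g

theorem map₂Rel_whisker_left {i j k : Carrier.{w, v, u} θ} (r : Rel i j) (s : Rel j k)
    (t : Rel i k) (f : i ⟶ j) {g g' : j ⟶ k} (η : g ⟶ g') :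
    D.map₂Rel t (f ◁ η) = (D.mapCompRel r s t f g).hom ≫ D.mapRel r f ◁ D.map₂Rel s η ≫
      (D.mapCompRel r s t f g').inv := by
  -- An order relation has at most one witness, so `t` may be taken to be the composite, which
  -- reduces in every case below.
  obtain rfl : t = r.trans s := Subsingleton.elim _ _
  cases r with
  | eq =>
    cases s with
    | eq => simp [Rel.trans, mapCompRel, map₂Rel, mapRel]
    | lt h =>
      simp only [Rel.trans, mapCompRel, map₂Rel, mapRel, Iso.trans_hom, Iso.trans_inv,
        map₂Iso_hom, map₂Iso_inv, Iso.symm_hom, Iso.symm_inv, id_whiskerLeft, Category.assoc,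
        Iso.inv_hom_id_assoc]
      rw [← D.map₂_comp, ← D.map₂_comp]
      congr 1
  | lt h =>
    cases s with
    | eq =>
      simp only [Rel.trans, mapCompRel, map₂Rel, mapRel, Iso.trans_hom, Iso.trans_inv,
        map₂Iso_hom, map₂Iso_inv, Iso.symm_hom, Iso.symm_inv, whiskerLeft_id, Category.assoc,
        Iso.inv_hom_id_assoc, Category.id_comp]
      rw [← D.map₂_comp]
      congr 1
    | lt h' => exact D.map₂_whisker_left h h' f η

theorem map₂Rel_whisker_right {i j k : Carrier.{w, v, u} θ} (r : Rel i j) (s : Rel j k)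
    (t : Rel i k) {f f' : i ⟶ j} (η : f ⟶ f') (g : j ⟶ k) :
    D.map₂Rel t (η ▷ g) = (D.mapCompRel r s t f g).hom ≫ D.map₂Rel r η ▷ D.mapRel s g ≫
      (D.mapCompRel r s t f' g).inv := by
  obtain rfl : t = r.trans s := Subsingleton.elim _ _
  cases r with
  | eq =>
    cases s with
    | eq => simp [Rel.trans, mapCompRel, map₂Rel, mapRel]
    | lt h =>
      simp only [Rel.trans, mapCompRel, map₂Rel, mapRel, Iso.trans_hom, Iso.trans_inv,
        map₂Iso_hom, map₂Iso_inv, Iso.symm_hom, Iso.symm_inv, id_whiskerRight, Category.assoc,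
        Iso.inv_hom_id_assoc, Category.id_comp]
      rw [← D.map₂_comp]
      congr 1
  | lt h =>
    cases s with
    | eq =>
      simp only [Rel.trans, mapCompRel, map₂Rel, mapRel, Iso.trans_hom, Iso.trans_inv,
        map₂Iso_hom, map₂Iso_inv, Iso.symm_hom, Iso.symm_inv, whiskerRight_id, Category.assoc,
        Iso.inv_hom_id_assoc]
      rw [← D.map₂_comp, ← D.map₂_comp]
      congr 1
    | lt h' => exact D.map₂_whisker_right h h' η g

/-- The whiskering law as naturality of the constraint; this moves images of unit equations past
constraints in the associativity law. -/
theorem mapComp_hom_whiskerRight {i j k : Carrier.{w, v, u} θ} (hij : ix i < ix j)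
    (hjk : ix j < ix k) {f f' : i ⟶ j} (η : f ⟶ f') (g : j ⟶ k) :
    (D.mapComp hij hjk f g).hom ≫ D.map₂ hij η ▷ D.map hjk g =
      D.map₂ (hij.trans hjk) (η ▷ g) ≫ (D.mapComp hij hjk f' g).hom := by
  rw [D.map₂_whisker_right hij hjk]
  simp

theorem mapComp_hom_whiskerLeft {i j k : Carrier.{w, v, u} θ} (hij : ix i < ix j)
    (hjk : ix j < ix k) (f : i ⟶ j) {g g' : j ⟶ k} (η : g ⟶ g') :
    (D.mapComp hij hjk f g).hom ≫ D.map hij f ◁ D.map₂ hjk η =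
      D.map₂ (hij.trans hjk) (f ◁ η) ≫ (D.mapComp hij hjk f g').hom := by
  rw [D.map₂_whisker_left hij hjk]
  simp

theorem mapComp_hom_whiskerRight_assoc {i j k : Carrier.{w, v, u} θ} (hij : ix i < ix j)
    (hjk : ix j < ix k) {f f' : i ⟶ j} (η : f ⟶ f') (g : j ⟶ k) {z : D.obj i ⟶ D.obj k}
    (φ : D.map hij f' ≫ D.map hjk g ⟶ z) :
    (D.mapComp hij hjk f g).hom ≫ D.map₂ hij η ▷ D.map hjk g ≫ φ =
      D.map₂ (hij.trans hjk) (η ▷ g) ≫ (D.mapComp hij hjk f' g).hom ≫ φ := by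
  rw [← Category.assoc, D.mapComp_hom_whiskerRight, Category.assoc]

theorem mapComp_hom_whiskerLeft_assoc {i j k : Carrier.{w, v, u} θ} (hij : ix i < ix j)
    (hjk : ix j < ix k) (f : i ⟶ j) {g g' : j ⟶ k} (η : g ⟶ g') {z : D.obj i ⟶ D.obj k}
    (φ : D.map hij f ≫ D.map hjk g' ⟶ z) :
    (D.mapComp hij hjk f g).hom ≫ D.map hij f ◁ D.map₂ hjk η ≫ φ =
      D.map₂ (hij.trans hjk) (f ◁ η) ≫ (D.mapComp hij hjk f g').hom ≫ φ := by
  rw [← Category.assoc, D.mapComp_hom_whiskerLeft, Category.assoc]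

/-- Only the case of three non-endomorphisms has content, and it is a field of the data. If a factor
is an identity, the constraints and unitors cancel until both sides are images of parallel 2-cells
of the source, which are equal. -/
theorem map₂Rel_associator {i j k l : Carrier.{w, v, u} θ} (r : Rel i j) (s : Rel j k)
    (t : Rel k l) (rs : Rel i k) (st : Rel j l) (rst : Rel i l)
    (f : i ⟶ j) (g : j ⟶ k) (h : k ⟶ l) :
    D.map₂Rel rst (α_ f g h).hom =
      (D.mapCompRel rs t rst (f ≫ g) h).hom ≫ (D.mapCompRel r s rs f g).hom ▷ D.mapRel t h ≫
        (α_ _ _ _).hom ≫ D.mapRel r f ◁ (D.mapCompRel s t st g h).inv ≫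
          (D.mapCompRel r st rst f (g ≫ h)).inv := by
  obtain rfl : rs = r.trans s := Subsingleton.elim _ _
  obtain rfl : st = s.trans t := Subsingleton.elim _ _
  obtain rfl : rst = r.trans (s.trans t) := Subsingleton.elim _ _
  cases r with
  | eq =>
    cases s with
    | eq =>
      cases t with
      | eq =>
        simp [Rel.trans, mapCompRel, map₂Rel, mapRel]
      | lt h =>
        simp [Rel.trans, mapCompRel, map₂Rel, mapRel]
        simp only [← D.map₂_comp]
        congr 1
    | lt h =>
      cases t with
      | eq =>
        simp [Rel.trans, mapCompRel, map₂Rel, mapRel]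
        simp only [← D.map₂_comp]
        congr 1
      | lt h =>
        simp [Rel.trans, mapCompRel, map₂Rel, mapRel, mapComp_hom_whiskerRight_assoc]
        simp only [← D.map₂_comp]
        congr 1
  | lt h =>
    cases s with
    | eq =>
      cases t with
      | eq =>
        simp [Rel.trans, mapCompRel, map₂Rel, mapRel]
        simp only [← D.map₂_comp]
        congr 1
      | lt h =>
        simp [Rel.trans, mapCompRel, map₂Rel, mapRel, mapComp_hom_whiskerRight_assoc,
          mapComp_hom_whiskerLeft_assoc]
        simp only [← D.map₂_comp]
        congr 1
    | lt h' =>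
      cases t with
      | eq =>
        simp [Rel.trans, mapCompRel, map₂Rel, mapRel, mapComp_hom_whiskerLeft_assoc]
        simp only [← D.map₂_comp]
        congr 1
      | lt h'' => exact D.map₂_associator h h' h'' _ _ _

theorem map₂Rel_left_unitor {i j : Carrier.{w, v, u} θ} (r : Rel i i) (s : Rel i j) (f : i ⟶ j)
    (e : D.mapRel r (𝟙 i) ≫ D.mapRel s f = 𝟙 _ ≫ D.mapRel s f) :
    D.map₂Rel s (λ_ f).hom =
      (D.mapCompRel r s s (𝟙 i) f).hom ≫ eqToHom e ≫ (λ_ (D.mapRel s f)).hom := by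
  obtain rfl : r = .eq i := Subsingleton.elim _ _
  cases s with
  | eq => simp [mapCompRel, map₂Rel, mapRel]
  | lt h =>
    simp [mapCompRel, map₂Rel, mapRel]
    congr 1

theorem map₂Rel_right_unitor {i j : Carrier.{w, v, u} θ} (r : Rel j j) (s : Rel i j) (f : i ⟶ j)
    (e : D.mapRel s f ≫ D.mapRel r (𝟙 j) = D.mapRel s f ≫ 𝟙 _) :
    D.map₂Rel s (ρ_ f).hom =
      (D.mapCompRel s r s f (𝟙 j)).hom ≫ eqToHom e ≫ (ρ_ (D.mapRel s f)).hom := by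
  obtain rfl : r = .eq j := Subsingleton.elim _ _
  cases s with
  | eq => simp [mapCompRel, map₂Rel, mapRel]
  | lt h =>
    simp [mapCompRel, map₂Rel, mapRel]
    congr 1

theorem mapRel_of_id (i : Carrier.{w, v, u} θ) : D.mapRel (Rel.of (ix_le (𝟙 i))) (𝟙 i) = 𝟙 _ := by
  rw [Subsingleton.elim (Rel.of (ix_le (𝟙 i))) (.eq i)]
  rfl

/-- The normal pseudofunctor given by its action on the morphisms that are not endomorphisms. -/
def toPseudofunctor : StrictlyUnitaryPseudofunctor (Carrier.{w, v, u} θ) A :=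
  StrictlyUnitaryPseudofunctor.mk'
    { obj := D.obj
      map := fun f => D.mapRel (Rel.of (ix_le f)) f
      map_id := D.mapRel_of_id
      map₂ := fun {_ _ f _} η => D.map₂Rel (Rel.of (ix_le f)) η
      map₂_id := fun _ => D.map₂Rel_id _ _
      map₂_comp := fun _ _ => D.map₂Rel_comp _ _ _
      mapComp := fun f g => D.mapCompRel _ _ _ f g
      map₂_whisker_left := fun f _ _ η => D.map₂Rel_whisker_left _ _ _ f η
      map₂_whisker_right := fun η g => D.map₂Rel_whisker_right _ _ _ η g
      map₂_left_unitor := fun f => D.map₂Rel_left_unitor _ _ f _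
      map₂_right_unitor := fun f => D.map₂Rel_right_unitor _ _ f _
      map₂_associator := fun f g h => D.map₂Rel_associator _ _ _ _ _ _ f g h }

/-- A composite with an identity factor is covered by the strict unit laws of the target, so `H` is
needed only on non-endomorphisms. -/
theorem toPseudofunctor_map_comp [Strict A]
    (H : ∀ {i j k : Carrier.{w, v, u} θ} (hij : ix i < ix j) (hjk : ix j < ix k)
      (f : i ⟶ j) (g : j ⟶ k), D.map (hij.trans hjk) (f ≫ g) = D.map hij f ≫ D.map hjk g)
    {i j k : Carrier.{w, v, u} θ} (f : i ⟶ j) (g : j ⟶ k) :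
    D.toPseudofunctor.map (f ≫ g) = D.toPseudofunctor.map f ≫ D.toPseudofunctor.map g := by
  have key : ∀ (r : Rel i j) (s : Rel j k) (t : Rel i k),
      D.mapRel t (f ≫ g) = D.mapRel r f ≫ D.mapRel s g := by
    intro r s t
    obtain rfl : t = r.trans s := Subsingleton.elim _ _
    cases r with
    | eq =>
      obtain rfl := endo_eq_id f
      rw [Strict.id_comp]
      exact (Strict.id_comp _).symm
    | lt h =>
      cases s with
      | eq =>
        obtain rfl := endo_eq_id g
        rw [Strict.comp_id]
        exact (Strict.comp_id _).symm
      | lt h' => exact H h h' f g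
  exact key _ _ _

end CellData

end PastingDiagram

/-! ### Equality of normal pseudofunctors -/

section

variable {A : Type u₁} [Bicategory.{w₁, v₁} A] {B : Type u₂} [Bicategory.{w₂, v₂} B]

theorem prelaxFunctor_ext_heq {F G : PrelaxFunctor A B} (hobj : ∀ a, F.obj a = G.obj a)
    (hmap : ∀ {a b : A} (f : a ⟶ b), HEq (F.map f) (G.map f))
    (hmap₂ : ∀ {a b : A} {f g : a ⟶ b} (η : f ⟶ g), HEq (F.map₂ η) (G.map₂ η)) : F = G := by
  obtain ⟨⟨⟨Fo, Fm⟩, F₂⟩, _, _⟩ := F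
  obtain ⟨⟨⟨Go, Gm⟩, G₂⟩, _, _⟩ := G
  obtain rfl : Fo = Go := funext hobj
  obtain rfl : @Fm = @Gm := by
    funext a b f
    exact eq_of_heq (hmap f)
  obtain rfl : @F₂ = @G₂ := by
    funext a b f g η
    exact eq_of_heq (hmap₂ η)
  rfl

/-- By normality the unit constraint is an `eqToIso`, hence carries no information beyond the action
on morphisms. -/
theorem normalPseudofunctor_mapId_heq {F G : StrictlyUnitaryPseudofunctor A B}
    (h : F.toPrelaxFunctor = G.toPrelaxFunctor) (a : A) : HEq (F.mapId a) (G.mapId a) := by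
  rw [F.mapId_eq_eqToIso, G.mapId_eq_eqToIso]
  obtain ⟨⟨F₀, F₁, F₂, _, _, _, _, _⟩, _, _⟩ := F
  obtain ⟨⟨G₀, G₁, G₂, _, _, _, _, _⟩, _, _⟩ := G
  dsimp only at h
  subst h
  rfl

/-- The unit law expresses a constraint with an identity factor through the unit constraint and the
image of a unitor. -/
theorem normalPseudofunctor_mapComp_id_left_heq {F G : StrictlyUnitaryPseudofunctor A B}
    (h : F.toPrelaxFunctor = G.toPrelaxFunctor) {a b : A} (f : a ⟶ b) :
    HEq (F.mapComp (𝟙 a) f) (G.mapComp (𝟙 a) f) := by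
  have h' := normalPseudofunctor_mapId_heq h a
  rw [F.mapComp_id_left, G.mapComp_id_left]
  obtain ⟨⟨F₀, F₁, F₂, _, _, _, _, _⟩, _, _⟩ := F
  obtain ⟨⟨G₀, G₁, G₂, _, _, _, _, _⟩, _, _⟩ := G
  dsimp only at h
  subst h
  dsimp only at h' ⊢
  rw [eq_of_heq h']

theorem normalPseudofunctor_mapComp_id_right_heq {F G : StrictlyUnitaryPseudofunctor A B}
    (h : F.toPrelaxFunctor = G.toPrelaxFunctor) {a b : A} (f : a ⟶ b) :
    HEq (F.mapComp f (𝟙 b)) (G.mapComp f (𝟙 b)) := by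
  have h' := normalPseudofunctor_mapId_heq h b
  rw [F.mapComp_id_right, G.mapComp_id_right]
  obtain ⟨⟨F₀, F₁, F₂, _, _, _, _, _⟩, _, _⟩ := F
  obtain ⟨⟨G₀, G₁, G₂, _, _, _, _, _⟩, _, _⟩ := G
  dsimp only at h
  subst h
  dsimp only at h' ⊢
  rw [eq_of_heq h']

theorem normalPseudofunctor_ext_heq {F G : StrictlyUnitaryPseudofunctor A B}
    (hobj : ∀ a, F.obj a = G.obj a)
    (hmap : ∀ {a b : A} (f : a ⟶ b), HEq (F.map f) (G.map f))
    (hmap₂ : ∀ {a b : A} {f g : a ⟶ b} (η : f ⟶ g), HEq (F.map₂ η) (G.map₂ η))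
    (hcomp : ∀ {a b c : A} (f : a ⟶ b) (g : b ⟶ c), HEq (F.mapComp f g) (G.mapComp f g)) :
    F = G :=
  have h := prelaxFunctor_ext_heq (F := F.toPrelaxFunctor) (G := G.toPrelaxFunctor) hobj hmap hmap₂
  normalPseudofunctor_ext h (normalPseudofunctor_mapId_heq h) hcomp

namespace CategoryTheory.StrictlyUnitaryPseudofunctor

/-- A copy of a normal pseudofunctor with prescribed (equal) actions on objects and morphisms. -/
def copy (G : StrictlyUnitaryPseudofunctor A B) (P : Prefunctor A B)
    (h : G.toPrelaxFunctor.toPrelaxFunctorStruct.toPrefunctor = P) :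
    StrictlyUnitaryPseudofunctor A B where
  obj := P.obj
  map := P.map
  map₂ {a b f g} η := Eq.rec (motive := fun P _ => P.map f ⟶ P.map g) (G.map₂ η) h
  map₂_id f := by subst h; exact G.map₂_id f
  map₂_comp η μ := by subst h; exact G.map₂_comp η μ
  mapId a := Eq.rec (motive := fun P _ => P.map (𝟙 a) ≅ 𝟙 (P.obj a)) (G.mapId a) h
  mapComp f g := Eq.rec (motive := fun P _ => P.map (f ≫ g) ≅ P.map f ≫ P.map g) (G.mapComp f g) h
  map₂_whisker_left f _ _ η := by subst h; exact G.map₂_whisker_left f η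
  map₂_whisker_right η f := by subst h; exact G.map₂_whisker_right η f
  map₂_associator f g k := by subst h; exact G.map₂_associator f g k
  map₂_left_unitor f := by subst h; exact G.map₂_left_unitor f
  map₂_right_unitor f := by subst h; exact G.map₂_right_unitor f
  map_id a := by subst h; exact G.map_id a
  mapId_eq_eqToIso a := by subst h; exact G.mapId_eq_eqToIso a

theorem copy_eq (G : StrictlyUnitaryPseudofunctor A B) (P : Prefunctor A B)
    (h : G.toPrelaxFunctor.toPrelaxFunctorStruct.toPrefunctor = P) : G.copy P h = G := by
  subst h
  rfl

theorem map_heq {F G : StrictlyUnitaryPseudofunctor A B} (h : F = G) {a b : A} (f : a ⟶ b) :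
    HEq (F.map f) (G.map f) := by
  rw [h]

theorem map₂_heq {F G : StrictlyUnitaryPseudofunctor A B} (h : F = G) {a b : A} {f g : a ⟶ b}
    (η : f ⟶ g) : HEq (F.map₂ η) (G.map₂ η) := by
  rw [h]

theorem mapComp_heq {F G : StrictlyUnitaryPseudofunctor A B} (h : F = G) {a b c : A} (f : a ⟶ b)
    (g : b ⟶ c) : HEq (F.mapComp f g) (G.mapComp f g) := by
  rw [h]

end CategoryTheory.StrictlyUnitaryPseudofunctor

end

namespace PastingDiagram

variable {θ : PastingDiagram} {B : Type u₂} [Bicategory.{w₂, v₂} B]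

/-- Normal pseudofunctors from `[n; m₁, …, mₙ]` are equal if they agree on the morphisms that are
not endomorphisms. -/
theorem pseudofunctor_ext {F G : StrictlyUnitaryPseudofunctor (Carrier.{w, v, u} θ) B}
    (hobj : ∀ i, F.obj i = G.obj i)
    (hmap : ∀ {i j : Carrier.{w, v, u} θ} (_ : ix i < ix j) (f : i ⟶ j), HEq (F.map f) (G.map f))
    (hmap₂ : ∀ {i j : Carrier.{w, v, u} θ} (_ : ix i < ix j) {f g : i ⟶ j} (η : f ⟶ g),
      HEq (F.map₂ η) (G.map₂ η))
    (hcomp : ∀ {i j k : Carrier.{w, v, u} θ} (_ : ix i < ix j) (_ : ix j < ix k)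
      (f : i ⟶ j) (g : j ⟶ k), HEq (F.mapComp f g) (G.mapComp f g)) :
    F = G := by
  have hmap' : ∀ {i j : Carrier.{w, v, u} θ} (f : i ⟶ j), HEq (F.map f) (G.map f) := by
    intro i j f
    rcases (ix_le f).lt_or_eq with h | h
    · exact hmap h f
    · obtain rfl := ix_ext h
      rw [endo_eq_id f, F.map_id, G.map_id, hobj i]
  have hp : F.toPrelaxFunctor = G.toPrelaxFunctor := by
    refine prelaxFunctor_ext_heq hobj hmap' ?_
    intro i j f g η
    rcases (ix_le f).lt_or_eq with h | h
    · exact hmap₂ h η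
    · obtain rfl := ix_ext h
      obtain rfl : f = g := Subsingleton.elim _ _
      rw [Subsingleton.elim η (𝟙 f), F.map₂_id, G.map₂_id]
      have h₁ := hobj i
      have h₂ := hmap' f
      revert h₂
      generalize F.map f = x
      generalize G.map f = y
      revert x y
      rw [h₁]
      rintro x y h
      rw [eq_of_heq h]
  refine normalPseudofunctor_ext hp (normalPseudofunctor_mapId_heq hp) ?_
  intro i j k f g
  rcases (ix_le f).lt_or_eq with h | h
  · rcases (ix_le g).lt_or_eq with h' | h'
    · exact hcomp h h' f g
    · obtain rfl := ix_ext h'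
      rw [endo_eq_id g]
      exact normalPseudofunctor_mapComp_id_right_heq hp f
  · obtain rfl := ix_ext h
    rw [endo_eq_id f]
    exact normalPseudofunctor_mapComp_id_left_heq hp g

end PastingDiagram

/-! ### Pseudofunctors out of shapes of length at most three -/

namespace PastingDiagram

/-- The object of `[n; m₁, …, mₙ]` with a given index. -/
abbrev pt {θ : PastingDiagram} (k : ℕ) (h : k < θ.n + 1 := by first | omega | (dsimp only; omega)) :
    Carrier.{w, v, u} θ :=
  ⟨⟨k, h⟩⟩

theorem pt_lt {θ : PastingDiagram} {a b : ℕ} {ha : a < θ.n + 1} {hb : b < θ.n + 1} (h : a < b) :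
    ix (pt.{w, v, u} a ha) < ix (pt.{w, v, u} b hb) := h

theorem not_pt_lt {θ : PastingDiagram} {a b : ℕ} {ha : a < θ.n + 1} {hb : b < θ.n + 1}
    (h : b ≤ a) (h' : ix (pt.{w, v, u} a ha) < ix (pt.{w, v, u} b hb)) : False :=
  absurd h' (not_lt.2 h)

-- This eliminates into data as well as propositions and computes on literal indices, so that the
-- pseudofunctors built from it evaluate definitionally.
@[elab_as_elim]
def pairElim₁ {m : Fin 1 → ℕ}
    {motive : ∀ i j : Carrier.{w, v, u} ⟨1, m⟩, ix i < ix j → Sort*}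
    (h01 : motive (pt 0) (pt 1) (pt_lt (by decide))) :
    ∀ i j (h : ix i < ix j), motive i j h
  | ⟨⟨0, _⟩⟩, ⟨⟨1, _⟩⟩, _ => h01
  | ⟨⟨0, _⟩⟩, ⟨⟨0, _⟩⟩, h => (not_pt_lt (by decide) h).elim
  | ⟨⟨1, _⟩⟩, ⟨⟨0, _⟩⟩, h => (not_pt_lt (by decide) h).elim
  | ⟨⟨1, _⟩⟩, ⟨⟨1, _⟩⟩, h => (not_pt_lt (by decide) h).elim

@[elab_as_elim]
def pairElim₂ {m : Fin 2 → ℕ}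
    {motive : ∀ i j : Carrier.{w, v, u} ⟨2, m⟩, ix i < ix j → Sort*}
    (h01 : motive (pt 0) (pt 1) (pt_lt (by decide))) (h02 : motive (pt 0) (pt 2) (pt_lt (by decide)))
    (h12 : motive (pt 1) (pt 2) (pt_lt (by decide))) :
    ∀ i j (h : ix i < ix j), motive i j h
  | ⟨⟨0, _⟩⟩, ⟨⟨1, _⟩⟩, _ => h01
  | ⟨⟨0, _⟩⟩, ⟨⟨2, _⟩⟩, _ => h02
  | ⟨⟨1, _⟩⟩, ⟨⟨2, _⟩⟩, _ => h12
  | ⟨⟨0, _⟩⟩, ⟨⟨0, _⟩⟩, h => (not_pt_lt (by decide) h).elim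
  | ⟨⟨1, _⟩⟩, ⟨⟨0, _⟩⟩, h => (not_pt_lt (by decide) h).elim
  | ⟨⟨1, _⟩⟩, ⟨⟨1, _⟩⟩, h => (not_pt_lt (by decide) h).elim
  | ⟨⟨2, _⟩⟩, ⟨⟨0, _⟩⟩, h => (not_pt_lt (by decide) h).elim
  | ⟨⟨2, _⟩⟩, ⟨⟨1, _⟩⟩, h => (not_pt_lt (by decide) h).elim
  | ⟨⟨2, _⟩⟩, ⟨⟨2, _⟩⟩, h => (not_pt_lt (by decide) h).elim

@[elab_as_elim]
def pairElim₃ {m : Fin 3 → ℕ}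
    {motive : ∀ i j : Carrier.{w, v, u} ⟨3, m⟩, ix i < ix j → Sort*}
    (h01 : motive (pt 0) (pt 1) (pt_lt (by decide))) (h02 : motive (pt 0) (pt 2) (pt_lt (by decide)))
    (h03 : motive (pt 0) (pt 3) (pt_lt (by decide))) (h12 : motive (pt 1) (pt 2) (pt_lt (by decide)))
    (h13 : motive (pt 1) (pt 3) (pt_lt (by decide))) (h23 : motive (pt 2) (pt 3) (pt_lt (by decide))) :
    ∀ i j (h : ix i < ix j), motive i j h
  | ⟨⟨0, _⟩⟩, ⟨⟨1, _⟩⟩, _ => h01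
  | ⟨⟨0, _⟩⟩, ⟨⟨2, _⟩⟩, _ => h02
  | ⟨⟨0, _⟩⟩, ⟨⟨3, _⟩⟩, _ => h03
  | ⟨⟨1, _⟩⟩, ⟨⟨2, _⟩⟩, _ => h12
  | ⟨⟨1, _⟩⟩, ⟨⟨3, _⟩⟩, _ => h13
  | ⟨⟨2, _⟩⟩, ⟨⟨3, _⟩⟩, _ => h23
  | ⟨⟨0, _⟩⟩, ⟨⟨0, _⟩⟩, h => (not_pt_lt (by decide) h).elim
  | ⟨⟨1, _⟩⟩, ⟨⟨0, _⟩⟩, h => (not_pt_lt (by decide) h).elim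
  | ⟨⟨1, _⟩⟩, ⟨⟨1, _⟩⟩, h => (not_pt_lt (by decide) h).elim
  | ⟨⟨2, _⟩⟩, ⟨⟨0, _⟩⟩, h => (not_pt_lt (by decide) h).elim
  | ⟨⟨2, _⟩⟩, ⟨⟨1, _⟩⟩, h => (not_pt_lt (by decide) h).elim
  | ⟨⟨2, _⟩⟩, ⟨⟨2, _⟩⟩, h => (not_pt_lt (by decide) h).elim
  | ⟨⟨3, _⟩⟩, ⟨⟨0, _⟩⟩, h => (not_pt_lt (by decide) h).elim
  | ⟨⟨3, _⟩⟩, ⟨⟨1, _⟩⟩, h => (not_pt_lt (by decide) h).elim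
  | ⟨⟨3, _⟩⟩, ⟨⟨2, _⟩⟩, h => (not_pt_lt (by decide) h).elim
  | ⟨⟨3, _⟩⟩, ⟨⟨3, _⟩⟩, h => (not_pt_lt (by decide) h).elim

theorem not_triple₁ {m : Fin 1 → ℕ} {i j k : Carrier.{w, v, u} ⟨1, m⟩} (h : ix i < ix j)
    (h' : ix j < ix k) : False := by
  have := (ix k).isLt
  simp only [Fin.lt_def] at h h'
  dsimp only at this
  omega

@[elab_as_elim]
def tripleElim₂ {m : Fin 2 → ℕ}
    {motive : ∀ i j k : Carrier.{w, v, u} ⟨2, m⟩, ix i < ix j → ix j < ix k → Sort*}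
    (h012 : motive (pt 0) (pt 1) (pt 2) (pt_lt (by decide)) (pt_lt (by decide))) :
    ∀ i j k (h : ix i < ix j) (h' : ix j < ix k), motive i j k h h'
  | ⟨⟨0, _⟩⟩, ⟨⟨1, _⟩⟩, ⟨⟨2, _⟩⟩, _, _ => h012
  | ⟨⟨1, _⟩⟩, ⟨⟨2, _⟩⟩, ⟨⟨k, hk⟩⟩, _, h => (not_pt_lt (Nat.le_of_lt_succ hk) h).elim
  | ⟨⟨0, _⟩⟩, ⟨⟨2, _⟩⟩, ⟨⟨k, hk⟩⟩, _, h => (not_pt_lt (Nat.le_of_lt_succ hk) h).elim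
  | ⟨⟨0, _⟩⟩, ⟨⟨1, _⟩⟩, ⟨⟨0, _⟩⟩, _, h => (not_pt_lt (by decide) h).elim
  | ⟨⟨0, _⟩⟩, ⟨⟨1, _⟩⟩, ⟨⟨1, _⟩⟩, _, h => (not_pt_lt (by decide) h).elim
  | ⟨⟨0, _⟩⟩, ⟨⟨0, _⟩⟩, _, h, _ => (not_pt_lt (by decide) h).elim
  | ⟨⟨1, _⟩⟩, ⟨⟨0, _⟩⟩, _, h, _ => (not_pt_lt (by decide) h).elim
  | ⟨⟨1, _⟩⟩, ⟨⟨1, _⟩⟩, _, h, _ => (not_pt_lt (by decide) h).elim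
  | ⟨⟨2, _⟩⟩, ⟨⟨j, hj⟩⟩, _, h, _ => (not_pt_lt (Nat.le_of_lt_succ hj) h).elim

theorem not_quadruple₂ {m : Fin 2 → ℕ} {i j k l : Carrier.{w, v, u} ⟨2, m⟩} (h : ix i < ix j)
    (h' : ix j < ix k) (h'' : ix k < ix l) : False := by
  have := (ix l).isLt
  simp only [Fin.lt_def] at h h' h''
  dsimp only at this
  omega

@[elab_as_elim]
def tripleElim₃ {m : Fin 3 → ℕ}
    {motive : ∀ i j k : Carrier.{w, v, u} ⟨3, m⟩, ix i < ix j → ix j < ix k → Sort*}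
    (h012 : motive (pt 0) (pt 1) (pt 2) (pt_lt (by decide)) (pt_lt (by decide)))
    (h013 : motive (pt 0) (pt 1) (pt 3) (pt_lt (by decide)) (pt_lt (by decide)))
    (h023 : motive (pt 0) (pt 2) (pt 3) (pt_lt (by decide)) (pt_lt (by decide)))
    (h123 : motive (pt 1) (pt 2) (pt 3) (pt_lt (by decide)) (pt_lt (by decide)))
    (i j k) (h : ix i < ix j) (h' : ix j < ix k) : motive i j k h h' := by
  revert h' k
  refine pairElim₃ (motive := fun i j h => ∀ k h', motive i j k h h') ?_ ?_ ?_ ?_ ?_ ?_ i j h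
  · exact fun
    | ⟨⟨2, _⟩⟩, _ => h012
    | ⟨⟨3, _⟩⟩, _ => h013
    | ⟨⟨0, _⟩⟩, h => (not_pt_lt (by decide) h).elim
    | ⟨⟨1, _⟩⟩, h => (not_pt_lt (by decide) h).elim
  · exact fun
    | ⟨⟨3, _⟩⟩, _ => h023
    | ⟨⟨0, _⟩⟩, h => (not_pt_lt (by decide) h).elim
    | ⟨⟨1, _⟩⟩, h => (not_pt_lt (by decide) h).elim
    | ⟨⟨2, _⟩⟩, h => (not_pt_lt (by decide) h).elim
  · exact fun ⟨⟨k, hk⟩⟩ h => (not_pt_lt (Nat.le_of_lt_succ hk) h).elim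
  · exact fun
    | ⟨⟨3, _⟩⟩, _ => h123
    | ⟨⟨0, _⟩⟩, h => (not_pt_lt (by decide) h).elim
    | ⟨⟨1, _⟩⟩, h => (not_pt_lt (by decide) h).elim
    | ⟨⟨2, _⟩⟩, h => (not_pt_lt (by decide) h).elim
  · exact fun ⟨⟨k, hk⟩⟩ h => (not_pt_lt (Nat.le_of_lt_succ hk) h).elim
  · exact fun ⟨⟨k, hk⟩⟩ h => (not_pt_lt (Nat.le_of_lt_succ hk) h).elim

theorem quadrupleElim₃ {m : Fin 3 → ℕ}
    {motive : ∀ i j k l : Carrier.{w, v, u} ⟨3, m⟩, ix i < ix j → ix j < ix k → ix k < ix l → Prop}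
    (h0123 : motive (pt 0) (pt 1) (pt 2) (pt 3) (pt_lt (by decide)) (pt_lt (by decide)) (pt_lt (by decide)))
    (i j k l) (h : ix i < ix j) (h' : ix j < ix k) (h'' : ix k < ix l) :
    motive i j k l h h' h'' := by
  have hl := (ix l).isLt
  have e : (ix i : ℕ) = 0 ∧ (ix j : ℕ) = 1 ∧ (ix k : ℕ) = 2 ∧ (ix l : ℕ) = 3 := by
    simp only [Fin.lt_def] at h h' h''
    dsimp only at hl
    omega
  obtain ⟨⟨i, hi⟩⟩ := i
  obtain ⟨⟨j, hj⟩⟩ := j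
  obtain ⟨⟨k, hk⟩⟩ := k
  obtain ⟨⟨l, hl⟩⟩ := l
  dsimp only [ix] at e
  obtain ⟨rfl, rfl, rfl, rfl⟩ := e
  exact h0123

theorem not_pair₀ {m : Fin 0 → ℕ} {i j : Carrier.{w, v, u} ⟨0, m⟩} (h : ix i < ix j) : False := by
  have := (ix j).isLt
  simp only [Fin.lt_def] at h
  dsimp only at this
  omega

variable {A : Type u} [Bicategory.{w, v} A]

/-- The normal pseudofunctor `[0] ⥤ A` with a given value. -/
def point (m : Fin 0 → ℕ) (a : A) : StrictlyUnitaryPseudofunctor (Carrier.{w, v, u} ⟨0, m⟩) A :=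
  CellData.toPseudofunctor
    { obj := fun _ => a
      map := fun h => (not_pair₀ h).elim
      map₂ := fun h => (not_pair₀ h).elim
      map₂_id := fun h => (not_pair₀ h).elim
      map₂_comp := fun h => (not_pair₀ h).elim
      mapComp := fun h => (not_pair₀ h).elim
      map₂_whisker_left := fun h => (not_pair₀ h).elim
      map₂_whisker_right := fun h => (not_pair₀ h).elim
      map₂_associator := fun h => (not_pair₀ h).elim }

section chain₁

variable {m : Fin 1 → ℕ} {a b : A} (K : ((pt 0 : Carrier.{w, v, u} ⟨1, m⟩) ⟶ pt 1) ⥤ (a ⟶ b))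

def chainObj₁ (m : Fin 1 → ℕ) (a b : A) : Carrier.{w, v, u} ⟨1, m⟩ → A
  | ⟨⟨0, _⟩⟩ => a
  | ⟨⟨1, _⟩⟩ => b

def chainMap₁ (i j : Carrier.{w, v, u} ⟨1, m⟩) (h : ix i < ix j) :
    (i ⟶ j) → (chainObj₁ m a b i ⟶ chainObj₁ m a b j) :=
  pairElim₁ (motive := fun i j _ => (i ⟶ j) → (chainObj₁ m a b i ⟶ chainObj₁ m a b j))
    K.obj i j h

def chainMap₂₁ (i j : Carrier.{w, v, u} ⟨1, m⟩) (h : ix i < ix j) :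
    ∀ {f g : i ⟶ j}, (f ⟶ g) → (chainMap₁ K i j h f ⟶ chainMap₁ K i j h g) :=
  pairElim₁ (motive := fun i j h => ∀ {f g : i ⟶ j}, (f ⟶ g) →
    (chainMap₁ K i j h f ⟶ chainMap₁ K i j h g)) K.map i j h

/-- The data of a normal pseudofunctor from `[1; m]`. -/
def chainData₁ : CellData.{w, v, u} ⟨1, m⟩ A where
  obj := chainObj₁ m a b
  map {i j} h := chainMap₁ K i j h
  map₂ {i j} h := chainMap₂₁ K i j h
  map₂_id {i j} h f := by
    induction i, j, h using pairElim₁ with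
    | h01 => exact K.map_id f
  map₂_comp {i j} h f g k η μ := by
    induction i, j, h using pairElim₁ with
    | h01 => exact K.map_comp η μ
  mapComp h h' := (not_triple₁ h h').elim
  map₂_whisker_left h h' := (not_triple₁ h h').elim
  map₂_whisker_right h h' := (not_triple₁ h h').elim
  map₂_associator h h' := (not_triple₁ h h').elim

/-- The normal pseudofunctor from `[1; m]` given by a functor from `[m]` to a hom-category. -/
def chain₁ : StrictlyUnitaryPseudofunctor (Carrier.{w, v, u} ⟨1, m⟩) A :=
  (chainData₁ K).toPseudofunctor

end chain₁

section chain₂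

variable {m : Fin 2 → ℕ} {a b c : A}

def chainObj₂ (m : Fin 2 → ℕ) (a b c : A) : Carrier.{w, v, u} ⟨2, m⟩ → A
  | ⟨⟨0, _⟩⟩ => a
  | ⟨⟨1, _⟩⟩ => b
  | ⟨⟨2, _⟩⟩ => c

/-- The data of a normal pseudofunctor from `[2; m₁, m₂]`. -/
structure Triangle (m : Fin 2 → ℕ) (a b c : A) where
  K01 : ((pt 0 : Carrier.{w, v, u} ⟨2, m⟩) ⟶ pt 1) ⥤ (a ⟶ b)
  K12 : ((pt 1 : Carrier.{w, v, u} ⟨2, m⟩) ⟶ pt 2) ⥤ (b ⟶ c)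
  K02 : ((pt 0 : Carrier.{w, v, u} ⟨2, m⟩) ⟶ pt 2) ⥤ (a ⟶ c)
  iso (f : (pt 0 : Carrier.{w, v, u} ⟨2, m⟩) ⟶ pt 1) (g : (pt 1 : Carrier.{w, v, u} ⟨2, m⟩) ⟶ pt 2) :
    K02.obj (f ≫ g) ≅ K01.obj f ≫ K12.obj g
  whisker_left (f : (pt 0 : Carrier.{w, v, u} ⟨2, m⟩) ⟶ pt 1)
    {g g' : (pt 1 : Carrier.{w, v, u} ⟨2, m⟩) ⟶ pt 2} (η : g ⟶ g') :
    K02.map (f ◁ η) = (iso f g).hom ≫ K01.obj f ◁ K12.map η ≫ (iso f g').inv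
  whisker_right {f f' : (pt 0 : Carrier.{w, v, u} ⟨2, m⟩) ⟶ pt 1} (η : f ⟶ f')
    (g : (pt 1 : Carrier.{w, v, u} ⟨2, m⟩) ⟶ pt 2) :
    K02.map (η ▷ g) = (iso f g).hom ≫ K01.map η ▷ K12.obj g ≫ (iso f' g).inv

variable (K : Triangle.{w, v, u} m a b c)

def chainMap₂ (i j : Carrier.{w, v, u} ⟨2, m⟩) (h : ix i < ix j) :
    (i ⟶ j) → (chainObj₂ m a b c i ⟶ chainObj₂ m a b c j) :=
  pairElim₂ (motive := fun i j _ => (i ⟶ j) → (chainObj₂ m a b c i ⟶ chainObj₂ m a b c j))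
    K.K01.obj K.K02.obj K.K12.obj i j h

def chainMap₂₂ (i j : Carrier.{w, v, u} ⟨2, m⟩) (h : ix i < ix j) :
    ∀ {f g : i ⟶ j}, (f ⟶ g) → (chainMap₂ K i j h f ⟶ chainMap₂ K i j h g) :=
  pairElim₂ (motive := fun i j h => ∀ {f g : i ⟶ j}, (f ⟶ g) →
    (chainMap₂ K i j h f ⟶ chainMap₂ K i j h g)) K.K01.map K.K02.map K.K12.map i j h

def chainComp₂ (i j k : Carrier.{w, v, u} ⟨2, m⟩) (h : ix i < ix j) (h' : ix j < ix k) :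
    ∀ (f : i ⟶ j) (g : j ⟶ k),
      chainMap₂ K i k (h.trans h') (f ≫ g) ≅ chainMap₂ K i j h f ≫ chainMap₂ K j k h' g :=
  tripleElim₂ (motive := fun i j k h h' => ∀ (f : i ⟶ j) (g : j ⟶ k),
      chainMap₂ K i k (h.trans h') (f ≫ g) ≅ chainMap₂ K i j h f ≫ chainMap₂ K j k h' g)
    K.iso i j k h h'

def chainData₂ : CellData.{w, v, u} ⟨2, m⟩ A where
  obj := chainObj₂ m a b c
  map {i j} h := chainMap₂ K i j h
  map₂ {i j} h := chainMap₂₂ K i j h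
  map₂_id {i j} h f := by
    induction i, j, h using pairElim₂ with
    | h01 => exact K.K01.map_id f
    | h02 => exact K.K02.map_id f
    | h12 => exact K.K12.map_id f
  map₂_comp {i j} h f g k η μ := by
    induction i, j, h using pairElim₂ with
    | h01 => exact K.K01.map_comp η μ
    | h02 => exact K.K02.map_comp η μ
    | h12 => exact K.K12.map_comp η μ
  mapComp {i j k} h h' := chainComp₂ K i j k h h'
  map₂_whisker_left {i j k} h h' f g g' η := by
    induction i, j, k, h, h' using tripleElim₂ with
    | h012 => exact K.whisker_left f η
  map₂_whisker_right {i j k} h h' f g g' η := by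
    induction i, j, k, h, h' using tripleElim₂ with
    | h012 => exact K.whisker_right g' η
  map₂_associator h h' h'' := (not_quadruple₂ h h' h'').elim

/-- The normal pseudofunctor from `[2; m₁, m₂]` given by functors to hom-categories. -/
def chain₂ : StrictlyUnitaryPseudofunctor (Carrier.{w, v, u} ⟨2, m⟩) A :=
  (chainData₂ K).toPseudofunctor

end chain₂

section chain₃

variable {a b c d : A} (f : a ⟶ b) (g : b ⟶ c) (h : c ⟶ d)

def chainObj₃ (a b c d : A) : Carrier.{w, v, u} ⟨3, fun _ => 0⟩ → A
  | ⟨⟨0, _⟩⟩ => a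
  | ⟨⟨1, _⟩⟩ => b
  | ⟨⟨2, _⟩⟩ => c
  | ⟨⟨3, _⟩⟩ => d

def chainMap₃ (i j : Carrier.{w, v, u} ⟨3, fun _ => 0⟩) (hij : ix i < ix j) :
    chainObj₃ a b c d i ⟶ chainObj₃ a b c d j :=
  pairElim₃ (motive := fun i j _ => chainObj₃ a b c d i ⟶ chainObj₃ a b c d j)
    f (f ≫ g) ((f ≫ g) ≫ h) g (g ≫ h) h i j hij

/-- The long edge is bracketed as `(f ≫ g) ≫ h`, so the associator of `A` appears only at the triple
`0, 1, 3`; this is how `[3; 0, 0, 0]` detects it. -/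
def chainComp₃ (i j k : Carrier.{w, v, u} ⟨3, fun _ => 0⟩) (hij : ix i < ix j) (hjk : ix j < ix k) :
    chainMap₃ f g h i k (hij.trans hjk) ≅ chainMap₃ f g h i j hij ≫ chainMap₃ f g h j k hjk :=
  tripleElim₃ (motive := fun i j k hij hjk =>
      chainMap₃ f g h i k (hij.trans hjk) ≅ chainMap₃ f g h i j hij ≫ chainMap₃ f g h j k hjk)
    (Iso.refl _) (α_ f g h) (Iso.refl _) (Iso.refl _) i j k hij hjk

def chainData₃ : CellData.{w, v, u} ⟨3, fun _ => 0⟩ A where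
  obj := chainObj₃ a b c d
  map {i j} hij _ := chainMap₃ f g h i j hij
  map₂ {i j} hij _ _ _ := 𝟙 _
  map₂_id {i j} hij f := rfl
  map₂_comp {i j} hij f g k η μ := (Category.comp_id _).symm
  mapComp {i j k} hij hjk _ _ := chainComp₃ f g h i j k hij hjk
  map₂_whisker_left {i j k} hij hjk _ _ _ _ := by simp
  map₂_whisker_right {i j k} hij hjk _ _ _ _ := by simp
  map₂_associator {i j k l} hij hjk hkl _ _ _ := by
    induction i, j, k, l, hij, hjk, hkl using quadrupleElim₃ with
    | h0123 =>
      change 𝟙 ((f ≫ g) ≫ h) = 𝟙 _ ≫ 𝟙 _ ▷ h ≫ (α_ f g h).hom ≫ f ◁ 𝟙 _ ≫ (α_ f g h).inv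
      simp

/-- The normal pseudofunctor from `[3; 0, 0, 0]` given by three composable morphisms. -/
def chain₃ : StrictlyUnitaryPseudofunctor (Carrier.{w, v, u} ⟨3, fun _ => 0⟩) A :=
  (chainData₃ f g h).toPseudofunctor

end chain₃

end PastingDiagram

/-! ### Test elements of the nerve -/

namespace PastingDiagram

/-- The functor that sends a morphism of `[n; m₁, …, mₙ]` to its component at `k`. -/
def label {θ : PastingDiagram} {i j : Carrier.{w, v, u} θ} (k : Fin θ.n) (h₁ : ix i ≤ k.castSucc)
    (h₂ : k.castSucc < ix j) : (i ⟶ j) ⥤ Fin (θ.m k + 1) where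
  obj f := Mor.val f k h₁ h₂
  map η := homOfLE (Cell.le η k h₁ h₂)

/-- The pasting diagrams of length zero, one and two. -/
abbrev pointShape : PastingDiagram := ⟨0, Fin.elim0⟩
abbrev segShape (m : ℕ) : PastingDiagram := ⟨1, fun _ => m⟩
abbrev triShape (m m' : ℕ) : PastingDiagram := ⟨2, ![m, m']⟩
abbrev tetShape : PastingDiagram := ⟨3, fun _ => 0⟩

def segLabel (m : ℕ) : ((pt 0 : Carrier.{w, v, u} (segShape m)) ⟶ pt 1) ⥤ Fin (m + 1) :=
  label (θ := segShape m) 0 (Fin.zero_le _) (Nat.zero_lt_one)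

/-- The morphism of `[1; m]` with a given label. -/
def segMor {m : ℕ} (l : Fin (m + 1)) : (pt 0 : Carrier.{w, v, u} (segShape m)) ⟶ pt 1 :=
  (⟨Fin.zero_le _, fun _ _ _ => l⟩ : Mor _ _)

def segCell {m : ℕ} {l l' : Fin (m + 1)} (h : l ≤ l') : segMor.{w, v, u} l ⟶ segMor l' :=
  (⟨fun _ _ _ => h⟩ : Cell _ _)

variable {A : Type u} [Bicategory.{w, v} A]

section tests

theorem map_endo {J C : Type*} [Preorder J] [Category* C] (F : J ⥤ C) {l : J} (φ : l ⟶ l) :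
    F.map φ = 𝟙 _ := by
  rw [Subsingleton.elim φ (𝟙 l), F.map_id]

variable {a b c d : A}

def arrow (f : a ⟶ b) : StrictlyUnitaryPseudofunctor (Carrier.{w, v, u} (segShape 0)) A :=
  chain₁ ((Functor.const _).obj f)

def cell {f g : a ⟶ b} (η : f ⟶ g) :
    StrictlyUnitaryPseudofunctor (Carrier.{w, v, u} (segShape 1)) A :=
  chain₁ (segLabel 1 ⋙ ComposableArrows.mk₁ η)

def cellPair {f g h : a ⟶ b} (η : f ⟶ g) (μ : g ⟶ h) :
    StrictlyUnitaryPseudofunctor (Carrier.{w, v, u} (segShape 2)) A :=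
  chain₁ (segLabel 2 ⋙ ComposableArrows.mk₂ η μ)

/-- The functor `[2; 0, 0] ⥤ A` given by two composable morphisms and a composite of them. -/
def triData (f : a ⟶ b) (g : b ⟶ c) (h : a ⟶ c) (σ : h ≅ f ≫ g) :
    Triangle.{w, v, u} ![0, 0] a b c where
  K01 := (Functor.const _).obj f
  K12 := (Functor.const _).obj g
  K02 := (Functor.const _).obj h
  iso _ _ := σ
  whisker_left _ _ _ _ := by simp
  whisker_right _ _ := by simp

def tri (f : a ⟶ b) (g : b ⟶ c) (h : a ⟶ c) (σ : h ≅ f ≫ g) :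
    StrictlyUnitaryPseudofunctor (Carrier.{w, v, u} (triShape 0 0)) A :=
  chain₂ (triData f g h σ)

def triLabel01 (m m' : ℕ) :
    ((pt 0 : Carrier.{w, v, u} (triShape m m')) ⟶ pt 1) ⥤ Fin (m + 1) :=
  label (θ := triShape m m') (0 : Fin 2) (Fin.zero_le _) Nat.zero_lt_one

def triLabel02 (m m' : ℕ) :
    ((pt 0 : Carrier.{w, v, u} (triShape m m')) ⟶ pt 2) ⥤ Fin (m + 1) :=
  label (θ := triShape m m') (0 : Fin 2) (Fin.zero_le _) Nat.zero_lt_two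

def triLabel12 (m m' : ℕ) :
    ((pt 1 : Carrier.{w, v, u} (triShape m m')) ⟶ pt 2) ⥤ Fin (m' + 1) :=
  label (θ := triShape m m') (1 : Fin 2) (le_refl (1 : Fin 3)) Nat.one_lt_two

/-- The morphisms from `0` to `2` form `[m] × [m']`; this is the projection complementary to
`triLabel02`. -/
def triLabel02' (m m' : ℕ) :
    ((pt 0 : Carrier.{w, v, u} (triShape m m')) ⟶ pt 2) ⥤ Fin (m' + 1) :=
  label (θ := triShape m m') (1 : Fin 2) (Fin.zero_le _) Nat.one_lt_two

def triMor01 {m m' : ℕ} (l : Fin (m + 1)) :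
    (pt 0 : Carrier.{w, v, u} (triShape m m')) ⟶ pt 1 :=
  (⟨Fin.zero_le _, fun
    | ⟨0, _⟩, _, _ => l
    | ⟨1, _⟩, _, h => absurd h (lt_irrefl (1 : Fin 3))⟩ : Mor _ _)

def triMor12 {m m' : ℕ} (l : Fin (m' + 1)) :
    (pt 1 : Carrier.{w, v, u} (triShape m m')) ⟶ pt 2 :=
  (⟨Fin.le_def.2 (Nat.le_succ 1), fun
    | ⟨1, _⟩, _, _ => l
    | ⟨0, _⟩, h, _ => absurd (Fin.le_def.1 h) (Nat.not_succ_le_zero 0)⟩ : Mor _ _)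

def triCell01 {m m' : ℕ} {l l' : Fin (m + 1)} (h : l ≤ l') :
    triMor01.{w, v, u} (m' := m') l ⟶ triMor01 l' :=
  (⟨fun
    | ⟨0, _⟩, _, _ => h
    | ⟨1, _⟩, _, h => absurd h (lt_irrefl (1 : Fin 3))⟩ : Cell _ _)

def triCell12 {m m' : ℕ} {l l' : Fin (m' + 1)} (h : l ≤ l') :
    triMor12.{w, v, u} (m := m) l ⟶ triMor12 l' :=
  (⟨fun
    | ⟨1, _⟩, _, _ => h
    | ⟨0, _⟩, h, _ => absurd (Fin.le_def.1 h) (Nat.not_succ_le_zero 0)⟩ : Cell _ _)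

/-- The constraints are identities, so the generating 2-cell and its whiskering go to `η` and to `η
▷ g` with no correction. The whiskering law for the image of this element is then the one for the
reconstructed pseudofunctor. -/
def whiskerRightData {f f' : a ⟶ b} (η : f ⟶ f') (g : b ⟶ c) :
    Triangle.{w, v, u} ![1, 0] a b c where
  K01 := triLabel01 1 0 ⋙ ComposableArrows.mk₁ η
  K12 := (Functor.const _).obj g
  K02 := triLabel02 1 0 ⋙ ComposableArrows.mk₁ η ⋙ postcomp a g
  iso _ _ := Iso.refl _
  whisker_left p q q' μ := by
    refine (congrArg (fun t => t ▷ g) (map_endo (ComposableArrows.mk₁ η)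
      (l := (triLabel01.{w, v, u} 1 0).obj p) ((triLabel02 1 0).map (p ◁ μ)))).trans ?_
    change 𝟙 _ ▷ g = 𝟙 _ ≫ _ ◁ 𝟙 _ ≫ 𝟙 _
    rw [id_whiskerRight, whiskerLeft_id, Category.comp_id, Category.comp_id]
  whisker_right {p p'} μ q := by
    change ((ComposableArrows.mk₁ η).map ((triLabel02 1 0).map (μ ▷ q))) ▷ g =
      𝟙 _ ≫ ((ComposableArrows.mk₁ η).map ((triLabel01 1 0).map μ)) ▷ g ≫ 𝟙 _
    rw [Category.id_comp, Category.comp_id]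
    rfl

def whiskerRightTest {f f' : a ⟶ b} (η : f ⟶ f') (g : b ⟶ c) :
    StrictlyUnitaryPseudofunctor (Carrier.{w, v, u} (triShape 1 0)) A :=
  chain₂ (whiskerRightData η g)

def whiskerLeftData (f : a ⟶ b) {g g' : b ⟶ c} (η : g ⟶ g') :
    Triangle.{w, v, u} ![0, 1] a b c where
  K01 := (Functor.const _).obj f
  K12 := triLabel12 0 1 ⋙ ComposableArrows.mk₁ η
  K02 := triLabel02' 0 1 ⋙ ComposableArrows.mk₁ η ⋙ precomp c f
  iso _ _ := Iso.refl _
  whisker_left p q q' μ := by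
    change f ◁ ((ComposableArrows.mk₁ η).map ((triLabel02' 0 1).map (p ◁ μ))) =
      𝟙 _ ≫ f ◁ ((ComposableArrows.mk₁ η).map ((triLabel12 0 1).map μ)) ≫ 𝟙 _
    rw [Category.id_comp, Category.comp_id]
    rfl
  whisker_right {p p'} μ q := by
    refine (congrArg (fun t => f ◁ t) (map_endo (ComposableArrows.mk₁ η)
      (l := (triLabel12.{w, v, u} 0 1).obj q) ((triLabel02' 0 1).map (μ ▷ q)))).trans ?_
    change f ◁ 𝟙 _ = 𝟙 _ ≫ 𝟙 _ ▷ _ ≫ 𝟙 _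
    rw [id_whiskerRight, whiskerLeft_id, Category.comp_id, Category.comp_id]

def whiskerLeftTest (f : a ⟶ b) {g g' : b ⟶ c} (η : g ⟶ g') :
    StrictlyUnitaryPseudofunctor (Carrier.{w, v, u} (triShape 0 1)) A :=
  chain₂ (whiskerLeftData f η)

/-- The isomorphisms from the objects of the sequence `h ⟶ f ≫ g` to `f ≫ g`. -/
def compositorIso {f : a ⟶ b} {g : b ⟶ c} {h : a ⟶ c} (σ : h ≅ f ≫ g) :
    ∀ l : Fin 2, (ComposableArrows.mk₁ σ.hom).obj l ≅ f ≫ g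
  | ⟨0, _⟩ => σ
  | ⟨1, _⟩ => Iso.refl _

/-- Each term of the sequence is identified with its last term `f ≫ g`, compatibly with the maps of
the sequence; these identifications therefore serve as constraints while the first edge stays
constant. -/
theorem compositorIso_naturality {f : a ⟶ b} {g : b ⟶ c} {h : a ⟶ c} (σ : h ≅ f ≫ g) :
    ∀ {l l' : Fin 2} (φ : l ⟶ l'), (ComposableArrows.mk₁ σ.hom).map φ =
      (compositorIso σ l).hom ≫ (compositorIso σ l').inv
  | ⟨0, _⟩, ⟨0, _⟩, φ => by
    exact (map_endo _ φ).trans (Iso.hom_inv_id _).symm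
  | ⟨0, _⟩, ⟨1, _⟩, φ => (Category.comp_id _).symm
  | ⟨1, _⟩, ⟨1, _⟩, φ => by
    exact (map_endo _ φ).trans (Iso.hom_inv_id _).symm
  | ⟨1, _⟩, ⟨0, _⟩, φ => absurd (leOfHom φ) (by simp)

/-- The functor from `[2; 1, 0]` that connects a composite of two morphisms with an arbitrary
one. -/
def compositorData {f : a ⟶ b} {g : b ⟶ c} {h : a ⟶ c} (σ : h ≅ f ≫ g) :
    Triangle.{w, v, u} ![1, 0] a b c where
  K01 := (Functor.const _).obj f
  K12 := (Functor.const _).obj g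
  K02 := triLabel02 1 0 ⋙ ComposableArrows.mk₁ σ.hom
  iso p q := compositorIso σ ((triLabel01.{w, v, u} 1 0).obj p)
  whisker_left p q q' μ := by
    change (ComposableArrows.mk₁ σ.hom).map ((triLabel02 1 0).map (p ◁ μ)) = _ ≫ _ ◁ 𝟙 _ ≫ _
    rw [compositorIso_naturality, whiskerLeft_id, Category.id_comp]
    rfl
  whisker_right {p p'} μ q := by
    change (ComposableArrows.mk₁ σ.hom).map ((triLabel02 1 0).map (μ ▷ q)) = _ ≫ 𝟙 _ ▷ _ ≫ _
    rw [compositorIso_naturality, id_whiskerRight, Category.id_comp]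
    rfl

def compositorTest {f : a ⟶ b} {g : b ⟶ c} {h : a ⟶ c} (σ : h ≅ f ≫ g) :
    StrictlyUnitaryPseudofunctor (Carrier.{w, v, u} (triShape 1 0)) A :=
  chain₂ (compositorData σ)

end tests

section strictness

variable [Strict A] {a b c d : A}

theorem point_map_comp (a : A) {i j k : Carrier.{w, v, u} pointShape} (p : i ⟶ j) (q : j ⟶ k) :
    (point Fin.elim0 a).map (p ≫ q) = (point _ a).map p ≫ (point _ a).map q :=
  CellData.toPseudofunctor_map_comp _ (fun h => (not_pair₀ h).elim) p q

theorem chain₁_map_comp {m : Fin 1 → ℕ} (K : ((pt 0 : Carrier.{w, v, u} ⟨1, m⟩) ⟶ pt 1) ⥤ (a ⟶ b))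
    {i j k : Carrier.{w, v, u} ⟨1, m⟩} (p : i ⟶ j) (q : j ⟶ k) :
    (chain₁ K).map (p ≫ q) = (chain₁ K).map p ≫ (chain₁ K).map q :=
  CellData.toPseudofunctor_map_comp _ (fun h h' => (not_triple₁ h h').elim) p q

theorem chain₂_map_comp {m : Fin 2 → ℕ} (K : Triangle.{w, v, u} m a b c)
    (H : ∀ (p : (pt 0 : Carrier.{w, v, u} ⟨2, m⟩) ⟶ pt 1)
      (q : (pt 1 : Carrier.{w, v, u} ⟨2, m⟩) ⟶ pt 2), K.K02.obj (p ≫ q) = K.K01.obj p ≫ K.K12.obj q)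
    {i j k : Carrier.{w, v, u} ⟨2, m⟩} (p : i ⟶ j) (q : j ⟶ k) :
    (chain₂ K).map (p ≫ q) = (chain₂ K).map p ≫ (chain₂ K).map q := by
  refine CellData.toPseudofunctor_map_comp _ ?_ p q
  intro i j k h h' p q
  induction i, j, k, h, h' using tripleElim₂ with
  | h012 => exact H p q

theorem chain₃_map_comp (f : a ⟶ b) (g : b ⟶ c) (h : c ⟶ d)
    {i j k : Carrier.{w, v, u} tetShape} (p : i ⟶ j) (q : j ⟶ k) :
    (chain₃ f g h).map (p ≫ q) = (chain₃ f g h).map p ≫ (chain₃ f g h).map q := by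
  refine CellData.toPseudofunctor_map_comp _ ?_ p q
  intro i j k h₁ h₂ p q
  induction i, j, k, h₁, h₂ using tripleElim₃ with
  | h012 => rfl
  | h013 => exact Strict.assoc f g h
  | h023 => rfl
  | h123 => rfl

theorem tri_map_comp (f : a ⟶ b) (g : b ⟶ c) (h : a ⟶ c) (σ : h ≅ f ≫ g) (e : h = f ≫ g)
    {i j k : Carrier.{w, v, u} (triShape 0 0)} (p : i ⟶ j) (q : j ⟶ k) :
    (tri f g h σ).map (p ≫ q) = (tri f g h σ).map p ≫ (tri f g h σ).map q :=
  chain₂_map_comp _ (fun _ _ => e) p q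

theorem whiskerRightTest_map_comp {f f' : a ⟶ b} (η : f ⟶ f') (g : b ⟶ c)
    {i j k : Carrier.{w, v, u} (triShape 1 0)} (p : i ⟶ j) (q : j ⟶ k) :
    (whiskerRightTest η g).map (p ≫ q) =
      (whiskerRightTest η g).map p ≫ (whiskerRightTest η g).map q :=
  chain₂_map_comp _ (fun _ _ => rfl) p q

theorem whiskerLeftTest_map_comp (f : a ⟶ b) {g g' : b ⟶ c} (η : g ⟶ g')
    {i j k : Carrier.{w, v, u} (triShape 0 1)} (p : i ⟶ j) (q : j ⟶ k) :
    (whiskerLeftTest f η).map (p ≫ q) =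
      (whiskerLeftTest f η).map p ≫ (whiskerLeftTest f η).map q :=
  chain₂_map_comp _ (fun _ _ => rfl) p q

theorem compositorTest_map_comp {f : a ⟶ b} {g : b ⟶ c} {h : a ⟶ c} (σ : h ≅ f ≫ g)
    (e : h = f ≫ g) {i j k : Carrier.{w, v, u} (triShape 1 0)} (p : i ⟶ j) (q : j ⟶ k) :
    (compositorTest σ).map (p ≫ q) = (compositorTest σ).map p ≫ (compositorTest σ).map q := by
  refine chain₂_map_comp _ (fun p q => ?_) p q
  change (ComposableArrows.mk₁ σ.hom).obj ((triLabel01.{w, v, u} 1 0).obj p) = f ≫ g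
  generalize (triLabel01.{w, v, u} 1 0).obj p = l
  match l with
  | ⟨0, _⟩ => exact e
  | ⟨1, _⟩ => rfl

end strictness

section postcomposition

variable {B : Type u} [Bicategory.{w, v} B] (F : StrictlyUnitaryPseudofunctor A B) {a b c d : A}

theorem point_comp (m : Fin 0 → ℕ) (a : A) : (point m a).comp F = point m (F.obj a) :=
  pseudofunctor_ext (fun _ => rfl) (fun h => (not_pair₀ h).elim) (fun h => (not_pair₀ h).elim)
    (fun h => (not_pair₀ h).elim)

theorem arrow_comp (f : a ⟶ b) : (arrow f).comp F = arrow (F.map f) := by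
  refine pseudofunctor_ext ?_ ?_ ?_ (fun h h' => (not_triple₁ h h').elim)
  · rintro ⟨⟨_ | _ | k, hk⟩⟩
    · rfl
    · rfl
    · exact absurd hk (by dsimp only; omega)
  · intro i j h p
    induction i, j, h using pairElim₁ with
    | h01 => rfl
  · intro i j h p q η
    induction i, j, h using pairElim₁ with
    | h01 => exact heq_of_eq (F.map₂_id f)

theorem mk₁_map {f g : a ⟶ b} (η : f ⟶ g) : ∀ (l : Fin 2),
    F.map ((ComposableArrows.mk₁ η).obj l) = (ComposableArrows.mk₁ (F.map₂ η)).obj l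
  | ⟨0, _⟩ => rfl
  | ⟨1, _⟩ => rfl

theorem mk₁_map₂ {f g : a ⟶ b} (η : f ⟶ g) : ∀ {l l' : Fin 2} (φ : l ⟶ l'),
    HEq (F.map₂ ((ComposableArrows.mk₁ η).map φ)) ((ComposableArrows.mk₁ (F.map₂ η)).map φ)
  | ⟨0, _⟩, ⟨0, _⟩, φ => by
    rw [map_endo _ φ, map_endo _ φ]
    exact heq_of_eq (F.map₂_id _)
  | ⟨0, _⟩, ⟨1, _⟩, φ => HEq.rfl
  | ⟨1, _⟩, ⟨1, _⟩, φ => by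
    rw [map_endo _ φ, map_endo _ φ]
    exact heq_of_eq (F.map₂_id _)
  | ⟨1, _⟩, ⟨0, _⟩, φ => absurd (leOfHom φ) (by simp)

theorem cell_comp {f g : a ⟶ b} (η : f ⟶ g) : (cell η).comp F = cell (F.map₂ η) := by
  refine pseudofunctor_ext ?_ ?_ ?_ (fun h h' => (not_triple₁ h h').elim)
  · rintro ⟨⟨_ | _ | k, hk⟩⟩
    · rfl
    · rfl
    · exact absurd hk (by dsimp only; omega)
  · intro i j h p
    induction i, j, h using pairElim₁ with
    | h01 => exact heq_of_eq (mk₁_map F η _)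
  · intro i j h p q μ
    induction i, j, h using pairElim₁ with
    | h01 => exact mk₁_map₂ F η ((segLabel 1).map μ)

/-- Postcomposition absorbs the constraint of `F` into `σ`. Hence triangles with arbitrary `σ` must
be considered, even to treat those with identity `σ`. -/
theorem tri_comp (f : a ⟶ b) (g : b ⟶ c) (h : a ⟶ c) (σ : h ≅ f ≫ g) :
    (tri f g h σ).comp F =
      tri (F.map f) (F.map g) (F.map h) (F.map₂Iso σ ≪≫ F.mapComp f g) := by
  refine pseudofunctor_ext ?_ ?_ ?_ ?_
  · rintro ⟨⟨_ | _ | _ | k, hk⟩⟩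
    · rfl
    · rfl
    · rfl
    · exact absurd hk (by dsimp only; omega)
  · intro i j h p
    induction i, j, h using pairElim₂ with
    | h01 => rfl
    | h02 => rfl
    | h12 => rfl
  · intro i j h p q μ
    induction i, j, h using pairElim₂ with
    | h01 => exact heq_of_eq (F.map₂_id _)
    | h02 => exact heq_of_eq (F.map₂_id _)
    | h12 => exact heq_of_eq (F.map₂_id _)
  · intro i j k h h' p q
    induction i, j, k, h, h' using tripleElim₂ with
    | h012 => rfl

end postcomposition

/-! ### 2-functors from test shapes into a pasting 2-category -/

section maps

variable {θ θ' : PastingDiagram}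

/-- A normal pseudofunctor into `[n; m₁, …, mₙ]` that preserves the composition of morphisms is
strict. -/
def toStrict {C : Type u} [Bicategory.{w, v} C]
    (F : StrictlyUnitaryPseudofunctor C (Carrier.{w, v, u} θ))
    (h : ∀ {a b c : C} (f : a ⟶ b) (g : b ⟶ c), F.map (f ≫ g) = F.map f ≫ F.map g) :
    StrictPseudofunctor C (Carrier.{w, v, u} θ) where
  toStrictlyUnitaryPseudofunctor := F
  map_comp := h
  mapComp_eq_eqToIso _ _ := Iso.ext (Subsingleton.elim _ _)

/-- Parallel 2-cells of the target coincide, so the actions on 2-cells and the constraints agree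
once their boundaries do. -/
theorem strictPseudofunctor_ext_carrier {C : Type u} [Bicategory.{w, v} C]
    {F G : StrictPseudofunctor C (Carrier.{w, v, u} θ)} (hobj : ∀ a, F.obj a = G.obj a)
    (hmap : ∀ {a b : C} (f : a ⟶ b), HEq (F.map f) (G.map f)) : F = G := by
  refine strictPseudofunctor_ext (normalPseudofunctor_ext_heq hobj hmap ?_ ?_)
  · intro a b f g η
    have h₁ := hmap f
    have h₂ := hmap g
    generalize F.map₂ η = x
    generalize G.map₂ η = y
    revert h₁ h₂ x y
    generalize F.map f = f₁
    generalize F.map g = g₁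
    generalize G.map f = f₂
    generalize G.map g = g₂
    revert f₁ g₁ f₂ g₂
    rw [hobj a, hobj b]
    rintro f₁ g₁ f₂ g₂ h₁ h₂ x y
    obtain rfl := eq_of_heq h₁
    obtain rfl := eq_of_heq h₂
    exact heq_of_eq (Subsingleton.elim _ _)
  · intro a b c f g
    have h₁ := hmap f
    have h₂ := hmap g
    have h₃ := hmap (f ≫ g)
    generalize F.mapComp f g = x
    generalize G.mapComp f g = y
    revert h₁ h₂ h₃ x y
    generalize F.map f = f₁
    generalize F.map g = g₁
    generalize F.map (f ≫ g) = k₁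
    generalize G.map f = f₂
    generalize G.map g = g₂
    generalize G.map (f ≫ g) = k₂
    revert f₁ g₁ k₁ f₂ g₂ k₂
    rw [hobj a, hobj b, hobj c]
    rintro f₁ g₁ k₁ f₂ g₂ k₂ h₁ h₂ h₃ x y
    obtain rfl := eq_of_heq h₁
    obtain rfl := eq_of_heq h₂
    obtain rfl := eq_of_heq h₃
    exact heq_of_eq (Iso.ext (Subsingleton.elim _ _))

def pointMap (i : Carrier.{w, v, u} θ) :
    StrictPseudofunctor (Carrier.{w, v, u} pointShape) (Carrier.{w, v, u} θ) :=
  toStrict (point Fin.elim0 i) (point_map_comp i)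

variable {i j k : Carrier.{w, v, u} θ}

def arrowMap (f : i ⟶ j) :
    StrictPseudofunctor (Carrier.{w, v, u} (segShape 0)) (Carrier.{w, v, u} θ) :=
  toStrict (arrow f) (chain₁_map_comp _)

def cellMap {f g : i ⟶ j} (η : f ⟶ g) :
    StrictPseudofunctor (Carrier.{w, v, u} (segShape 1)) (Carrier.{w, v, u} θ) :=
  toStrict (cell η) (chain₁_map_comp _)

def triMap (f : i ⟶ j) (g : j ⟶ k) :
    StrictPseudofunctor (Carrier.{w, v, u} (triShape 0 0)) (Carrier.{w, v, u} θ) :=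
  toStrict (tri f g (f ≫ g) (Iso.refl _)) (tri_map_comp f g _ _ rfl)

theorem pointMap_comp (s : StrictPseudofunctor (Carrier.{w, v, u} θ) (Carrier.{w, v, u} θ')) :
    (pointMap i).comp s = pointMap (s.obj i) :=
  strictPseudofunctor_ext (point_comp _ _ _)

theorem arrowMap_comp (s : StrictPseudofunctor (Carrier.{w, v, u} θ) (Carrier.{w, v, u} θ'))
    (f : i ⟶ j) : (arrowMap f).comp s = arrowMap (s.map f) :=
  strictPseudofunctor_ext (arrow_comp _ _)

theorem triMap_comp (s : StrictPseudofunctor (Carrier.{w, v, u} θ) (Carrier.{w, v, u} θ'))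
    (f : i ⟶ j) (g : j ⟶ k) : (triMap f g).comp s = triMap (s.map f) (s.map g) := by
  have key (x : s.obj i ⟶ s.obj k) (σ : x ≅ s.map f ≫ s.map g) (e : x = s.map f ≫ s.map g) :
      tri (s.map f) (s.map g) x σ = tri (s.map f) (s.map g) _ (Iso.refl _) := by
    subst e
    congr 1
  exact strictPseudofunctor_ext ((tri_comp _ _ _ _ _).trans (key _ _ (s.map_comp f g)))

theorem cellMap_comp (s : StrictPseudofunctor (Carrier.{w, v, u} θ) (Carrier.{w, v, u} θ'))
    {f g : i ⟶ j} (η : f ⟶ g) : (cellMap η).comp s = cellMap (s.map₂ η) :=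
  strictPseudofunctor_ext (cell_comp _ _)

end maps

end PastingDiagram

/-! ### Naturality beyond the generators -/

namespace PastingDiagram

/-- A 2-functor that is injective on objects and on morphisms. -/
structure IsInjective {A B : Type u} [Bicategory.{w, v} A] [Bicategory.{w, v} B]
    (s : StrictPseudofunctor A B) : Prop where
  obj : ∀ {a b : A}, s.obj a = s.obj b → a = b
  map : ∀ {a b : A} {f g : a ⟶ b}, s.map f = s.map g → f = g

theorem segShape_hom_ext {m : ℕ} {p q : (pt 0 : Carrier.{w, v, u} (segShape m)) ⟶ pt 1}
    (h : (segLabel m).obj p = (segLabel m).obj q) : p = q :=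
  Mor.ext fun
    | ⟨0, _⟩, _, _ => h

instance triShape_hom_subsingleton {i j : Carrier.{w, v, u} (triShape 0 0)} :
    Subsingleton (i ⟶ j) where
  allEq _ _ := Mor.ext fun
    | ⟨0, _⟩, _, _ => Subsingleton.elim (α := Fin 1) _ _
    | ⟨1, _⟩, _, _ => Subsingleton.elim (α := Fin 1) _ _

section

variable {θ : PastingDiagram} {i j k : Carrier.{w, v, u} θ}

theorem cellMap_isInjective (h : ix i < ix j) {f g : i ⟶ j} (η : f ⟶ g) (hfg : f ≠ g) :
    IsInjective (cellMap η) where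
  obj {a b} e := by
    have hij : i ≠ j := fun e => (congrArg ix e).not_lt h
    match a, b with
    | ⟨⟨0, _⟩⟩, ⟨⟨0, _⟩⟩ => rfl
    | ⟨⟨1, _⟩⟩, ⟨⟨1, _⟩⟩ => rfl
    | ⟨⟨0, _⟩⟩, ⟨⟨1, _⟩⟩ => exact absurd e hij
    | ⟨⟨1, _⟩⟩, ⟨⟨0, _⟩⟩ => exact absurd e hij.symm
  map {a b p q} e := by
    rcases (ix_le p).lt_or_eq with hab | hab
    · induction a, b, hab using pairElim₁ with
      | h01 =>
        apply segShape_hom_ext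
        change (ComposableArrows.mk₁ η).obj ((segLabel 1).obj p) =
          (ComposableArrows.mk₁ η).obj ((segLabel 1).obj q) at e
        revert e
        generalize (segLabel 1).obj p = l
        generalize (segLabel 1).obj q = l'
        intro e
        match l, l' with
        | ⟨0, _⟩, ⟨0, _⟩ => rfl
        | ⟨1, _⟩, ⟨1, _⟩ => rfl
        | ⟨0, _⟩, ⟨1, _⟩ => exact absurd e hfg
        | ⟨1, _⟩, ⟨0, _⟩ => exact absurd e hfg.symm
    · obtain rfl := ix_ext hab
      exact Subsingleton.elim _ _

theorem triMap_isInjective (h : ix i < ix j) (h' : ix j < ix k) (f : i ⟶ j) (g : j ⟶ k) :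
    IsInjective (triMap f g) where
  obj {a b} e := by
    have hij : i ≠ j := fun e => (congrArg ix e).not_lt h
    have hjk : j ≠ k := fun e => (congrArg ix e).not_lt h'
    have hik : i ≠ k := fun e => (congrArg ix e).not_lt (h.trans h')
    match a, b with
    | ⟨⟨0, _⟩⟩, ⟨⟨0, _⟩⟩ => rfl
    | ⟨⟨1, _⟩⟩, ⟨⟨1, _⟩⟩ => rfl
    | ⟨⟨2, _⟩⟩, ⟨⟨2, _⟩⟩ => rfl
    | ⟨⟨0, _⟩⟩, ⟨⟨1, _⟩⟩ => exact absurd e hij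
    | ⟨⟨1, _⟩⟩, ⟨⟨0, _⟩⟩ => exact absurd e hij.symm
    | ⟨⟨0, _⟩⟩, ⟨⟨2, _⟩⟩ => exact absurd e hik
    | ⟨⟨2, _⟩⟩, ⟨⟨0, _⟩⟩ => exact absurd e hik.symm
    | ⟨⟨1, _⟩⟩, ⟨⟨2, _⟩⟩ => exact absurd e hjk
    | ⟨⟨2, _⟩⟩, ⟨⟨1, _⟩⟩ => exact absurd e hjk.symm
  map _ := Subsingleton.elim _ _

end

/-- The normal pseudofunctors from `[n; m₁, …, mₙ]` to `A`, or only those that preserve the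
composition of morphisms strictly if `Q` holds. -/
def Admissible (Q : Prop) {C A : Type u} [Bicategory.{w, v} C] [Bicategory.{w, v} A]
    (x : StrictlyUnitaryPseudofunctor C A) : Prop :=
  Q → ∀ {a b c : C} (f : a ⟶ b) (g : b ⟶ c), x.map (f ≫ g) = x.map f ≫ x.map g

theorem Admissible.comp {Q : Prop} {C D A : Type u} [Bicategory.{w, v} C] [Bicategory.{w, v} D]
    [Bicategory.{w, v} A] {x : StrictlyUnitaryPseudofunctor D A} (hx : Admissible Q x)
    (s : StrictPseudofunctor C D) :
    Admissible Q (s.toStrictlyUnitaryPseudofunctor.comp x) := by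
  intro hQ a b c f g
  exact (congrArg x.map (s.map_comp f g)).trans (hx hQ _ _)

/-- A natural transformation to the truncated nerve of `B` from the presheaf of the admissible
elements of the truncated nerve of `A`. -/
structure NerveMap (Q : Prop) (A B : Type u) [Bicategory.{w, v} A] [Bicategory.{w, v} B] where
  app (θ : PastingDiagram) (hθ : θ.degree ≤ 3)
    (x : StrictlyUnitaryPseudofunctor (Carrier.{w, v, u} θ) A) (hx : Admissible Q x) :
    StrictlyUnitaryPseudofunctor (Carrier.{w, v, u} θ) B
  nat_low {θ θ' : PastingDiagram} (hθ : θ.degree ≤ 3) (hθ' : θ'.degree ≤ 3)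
    (h : θ.degree ≤ 2) (h' : θ'.degree ≤ 2)
    (s : StrictPseudofunctor (Carrier.{w, v, u} θ) (Carrier.{w, v, u} θ'))
    (x : StrictlyUnitaryPseudofunctor (Carrier.{w, v, u} θ') A) (hx : Admissible Q x) :
    app θ hθ (s.toStrictlyUnitaryPseudofunctor.comp x) (hx.comp s) =
      s.toStrictlyUnitaryPseudofunctor.comp (app θ' hθ' x hx)
  nat_mono {θ θ' : PastingDiagram} (hθ : θ.degree ≤ 3) (hθ' : θ'.degree ≤ 3)
    (h : θ.degree = 2) (h' : θ'.degree = 3)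
    (s : StrictPseudofunctor (Carrier.{w, v, u} θ) (Carrier.{w, v, u} θ')) (hs : IsInjective s)
    (x : StrictlyUnitaryPseudofunctor (Carrier.{w, v, u} θ') A) (hx : Admissible Q x) :
    app θ hθ (s.toStrictlyUnitaryPseudofunctor.comp x) (hx.comp s) =
      s.toStrictlyUnitaryPseudofunctor.comp (app θ' hθ' x hx)

theorem degree_segShape (m : ℕ) : (segShape m).degree = 1 + m := by simp [degree]

theorem degree_triShape (m m' : ℕ) : (triShape m m').degree = 2 + (m + m') := by simp [degree]

theorem degree_tetShape : tetShape.degree = 3 := rfl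

namespace NerveMap

variable {Q : Prop} {A B : Type u} [Bicategory.{w, v} A] [Bicategory.{w, v} B]
  (D : NerveMap Q A B) {θ θ' θ'' : PastingDiagram}

theorem app_congr (hθ : θ.degree ≤ 3) {x y : StrictlyUnitaryPseudofunctor (Carrier.{w, v, u} θ) A}
    (e : x = y) (hx : Admissible Q x) (hy : Admissible Q y) : D.app θ hθ x hx = D.app θ hθ y hy := by
  subst e
  rfl

/-- Naturality at a single 2-functor, which need not be a generator or even lie in `Θ_b`. -/
def NatAt (s : StrictPseudofunctor (Carrier.{w, v, u} θ) (Carrier.{w, v, u} θ')) : Prop :=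
  ∀ (hθ : θ.degree ≤ 3) (hθ' : θ'.degree ≤ 3)
    (x : StrictlyUnitaryPseudofunctor (Carrier.{w, v, u} θ') A) (hx : Admissible Q x),
    D.app θ hθ (s.toStrictlyUnitaryPseudofunctor.comp x) (hx.comp s) =
      s.toStrictlyUnitaryPseudofunctor.comp (D.app θ' hθ' x hx)

theorem natAt_comp (h' : θ'.degree ≤ 3)
    {s : StrictPseudofunctor (Carrier.{w, v, u} θ) (Carrier.{w, v, u} θ')}
    {t : StrictPseudofunctor (Carrier.{w, v, u} θ') (Carrier.{w, v, u} θ'')}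
    (hs : D.NatAt s) (ht : D.NatAt t) : D.NatAt (s.comp t) := by
  intro hθ hθ'' x hx
  have assoc (y : StrictlyUnitaryPseudofunctor (Carrier.{w, v, u} θ'') A) :=
    Category.assoc (W := Bicat.mk (Carrier.{w, v, u} θ)) (X := Bicat.mk (Carrier.{w, v, u} θ'))
      (Y := Bicat.mk (Carrier.{w, v, u} θ'')) (Z := Bicat.mk A)
      s.toStrictlyUnitaryPseudofunctor t.toStrictlyUnitaryPseudofunctor y
  have assoc' (y : StrictlyUnitaryPseudofunctor (Carrier.{w, v, u} θ'') B) :=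
    Category.assoc (W := Bicat.mk (Carrier.{w, v, u} θ)) (X := Bicat.mk (Carrier.{w, v, u} θ'))
      (Y := Bicat.mk (Carrier.{w, v, u} θ'')) (Z := Bicat.mk B)
      s.toStrictlyUnitaryPseudofunctor t.toStrictlyUnitaryPseudofunctor y
  refine (D.app_congr hθ (assoc x) _ ((hx.comp t).comp s)).trans ?_
  refine (hs hθ h' _ (hx.comp t)).trans ?_
  rw [ht h' hθ'' x hx]
  exact (assoc' _).symm

theorem natAt_low (h : θ.degree ≤ 2) (h' : θ'.degree ≤ 2)
    (s : StrictPseudofunctor (Carrier.{w, v, u} θ) (Carrier.{w, v, u} θ')) : D.NatAt s :=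
  fun hθ hθ' x hx => D.nat_low hθ hθ' h h' s x hx

/-- Naturality with respect to a morphism that factors through an object of degree at most two. -/
theorem natAt_of_factor (h : θ.degree ≤ 2) (h' : θ'.degree ≤ 2)
    (s : StrictPseudofunctor (Carrier.{w, v, u} θ) (Carrier.{w, v, u} θ'))
    {t : StrictPseudofunctor (Carrier.{w, v, u} θ') (Carrier.{w, v, u} θ'')}
    (ht : D.NatAt t) {r : StrictPseudofunctor (Carrier.{w, v, u} θ) (Carrier.{w, v, u} θ'')}
    (e : s.comp t = r) : D.NatAt r :=
  e ▸ D.natAt_comp (h'.trans (by decide)) (D.natAt_low h h' s) ht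

variable {i j k : Carrier.{w, v, u} θ}

/-- `[2; 0, 0]` has degree exactly two, and strictness of both inequalities makes the pair
injective; so it is a generator into any target of degree at most three. -/
theorem natAt_triMap_of_lt (hij : ix i < ix j) (hjk : ix j < ix k) (f : i ⟶ j) (g : j ⟶ k) :
    D.NatAt (triMap f g) := by
  intro h₁ h₂ x hx
  by_cases h : θ.degree ≤ 2
  · exact D.nat_low _ _ (degree_triShape 0 0).le h _ _ _
  · exact D.nat_mono _ _ (degree_triShape 0 0) (by omega) _ (triMap_isInjective hij hjk f g) _ _

theorem natAt_cellMap_of_ne (hij : ix i < ix j) {f g : i ⟶ j} (η : f ⟶ g) (hfg : f ≠ g) :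
    D.NatAt (cellMap η) := by
  intro h₁ h₂ x hx
  by_cases h : θ.degree ≤ 2
  · exact D.nat_low _ _ (degree_segShape 1).le h _ _ _
  · exact D.nat_mono _ _ (degree_segShape 1) (by omega) _ (cellMap_isInjective hij η hfg) _ _

/-- The morphism of `[n; m₁, …, mₙ]` with all components zero. -/
def zeroMor {i j : Carrier.{w, v, u} θ} (h : ix i ≤ ix j) : i ⟶ j :=
  (⟨h, fun _ _ _ => 0⟩ : Mor _ _)

/-- The morphism of `[n; m₁, …, mₙ]` with all components maximal. -/
def topMor {i j : Carrier.{w, v, u} θ} (h : ix i ≤ ix j) : i ⟶ j :=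
  (⟨h, fun _ _ _ => Fin.last _⟩ : Mor _ _)

/-- A morphism is a tuple of coordinates, which can be cut at `j`. -/
theorem exists_factor (hij : ix i ≤ ix j) (hjk : ix j ≤ ix k) (f : i ⟶ k) :
    ∃ (p : i ⟶ j) (q : j ⟶ k), p ≫ q = f := by
  refine ⟨(⟨hij, fun l h₁ h₂ => Mor.val f l h₁ (h₂.trans_le hjk)⟩ : Mor _ _),
    (⟨hjk, fun l h₁ h₂ => Mor.val f l (hij.trans h₁) h₂⟩ : Mor _ _), Mor.ext fun l h₁ h₂ => ?_⟩
  change (if h : l.castSucc < ix j then Mor.val f l h₁ _ else Mor.val f l _ h₂) = Mor.val f l h₁ h₂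
  split_ifs <;> rfl

/-- A positive width makes the zero and the top morphism differ. So `f` is an end of a nonidentity
2-cell: its source, towards the top, if `f` is zero, and otherwise its target, from zero. -/
theorem natAt_arrowMap_of_le_mul (hij : ix i < ix j) (f : i ⟶ j) (k : Fin θ.n)
    (h₁ : ix i ≤ k.castSucc) (h₂ : k.castSucc < ix j) (hk : 1 ≤ θ.m k) : D.NatAt (arrowMap f) := by
  have d₀ : (segShape 0).degree ≤ 2 := (degree_segShape 0).trans_le (by decide)
  have d₁ : (segShape 1).degree ≤ 2 := (degree_segShape 1).le
  by_cases hf : zeroMor hij.le = f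
  · let η : f ⟶ topMor hij.le := (⟨fun _ _ _ => Fin.le_last _⟩ : Cell _ _)
    have hne : f ≠ topMor hij.le := by
      intro e
      have e' : (0 : Fin (θ.m k + 1)) = Fin.last _ :=
        congrArg (fun t : i ⟶ j => Mor.val t k h₁ h₂) (hf.trans e)
      have := congrArg Fin.val e'
      simp only [Fin.val_zero, Fin.val_last] at this
      omega
    exact D.natAt_of_factor d₀ d₁ (arrowMap (segMor 0)) (D.natAt_cellMap_of_ne hij η hne)
      (arrowMap_comp _ _)
  · let η : zeroMor hij.le ⟶ f := (⟨fun _ _ _ => Fin.zero_le _⟩ : Cell _ _)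
    exact D.natAt_of_factor d₀ d₁ (arrowMap (segMor 1)) (D.natAt_cellMap_of_ne hij η hf)
      (arrowMap_comp _ _)

/-- No generator goes directly from `[1; 0]` to degree three, so the arrow must be a face of
something of degree two. It can be extended to a composable pair on the left or on the right, or be
cut in two, unless it spans a shape of length one. -/
theorem natAt_arrowMap_of_lt (hθ : 2 < θ.degree) (hij : ix i < ix j) (f : i ⟶ j) :
    D.NatAt (arrowMap f) := by
  have d₁ : (segShape 0).degree ≤ 2 := (degree_segShape 0).trans_le (by decide)
  have d₃ : (triShape 0 0).degree ≤ 2 := (degree_triShape 0 0).le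
  have hj : (ix j : ℕ) < θ.n + 1 := (ix j).isLt
  have hij' := Fin.lt_def.1 hij
  by_cases h₀ : 0 < (ix i : ℕ)
  · have h : ix (pt 0 : Carrier.{w, v, u} θ) < ix i := h₀
    exact D.natAt_of_factor d₁ d₃ (arrowMap (triMor12 0))
      (D.natAt_triMap_of_lt h hij (zeroMor h.le) f) (arrowMap_comp _ _)
  by_cases h₁ : (ix j : ℕ) < θ.n
  · have h : ix j < ix (pt θ.n : Carrier.{w, v, u} θ) := h₁
    exact D.natAt_of_factor d₁ d₃ (arrowMap (triMor01 0))
      (D.natAt_triMap_of_lt hij h f (zeroMor h.le)) (arrowMap_comp _ _)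
  by_cases h₂ : 2 ≤ θ.n
  · have h : ix i < ix (pt 1 (by omega) : Carrier.{w, v, u} θ) := Fin.lt_def.2 (by dsimp only; omega)
    have h' : ix (pt 1 (by omega) : Carrier.{w, v, u} θ) < ix j := Fin.lt_def.2 (by dsimp only; omega)
    obtain ⟨p, q, rfl⟩ := exists_factor h.le h'.le f
    exact D.natAt_of_factor d₁ d₃ (arrowMap (triMor01 0 ≫ triMor12 0))
      (D.natAt_triMap_of_lt h h' p q) (arrowMap_comp _ _)
  -- Here `f` goes from `0` to `1` in a shape of length one; a degree above two forces its width to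
  -- be at least two, so that nonidentity 2-cells exist.
  · obtain ⟨n, m⟩ := θ
    obtain rfl : n = 1 := by
      dsimp only at h₂ hj
      omega
    refine D.natAt_arrowMap_of_le_mul hij f (0 : Fin 1) (Fin.le_def.2 (by dsimp; omega))
      (Fin.lt_def.2 (by dsimp; omega)) ?_
    simp [degree] at hθ
    dsimp only
    omega

theorem natAt_arrowMap_of_lt' (hij : ix i < ix j) (f : i ⟶ j) : D.NatAt (arrowMap f) := by
  by_cases h : θ.degree ≤ 2
  · exact D.natAt_low ((degree_segShape 0).trans_le (by decide)) h _
  · exact D.natAt_arrowMap_of_lt (not_le.1 h) hij f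

/-- Above degree two the length is not zero, so each point is an end of an arrow between distinct
points. -/
theorem natAt_pointMap (i : Carrier.{w, v, u} θ) : D.NatAt (pointMap i) := by
  by_cases h : θ.degree ≤ 2
  · exact D.natAt_low (by decide) h _
  have d₁ : (segShape 0).degree ≤ 2 := (degree_segShape 0).trans_le (by decide)
  have hi : (ix i : ℕ) < θ.n + 1 := (ix i).isLt
  by_cases h₀ : 0 < (ix i : ℕ)
  · have h : ix (pt 0 : Carrier.{w, v, u} θ) < ix i := h₀
    exact D.natAt_of_factor (by decide) d₁ (pointMap (pt 1))
      (D.natAt_arrowMap_of_lt' h (zeroMor h.le)) (pointMap_comp _)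
  by_cases h₁ : (ix i : ℕ) < θ.n
  · have h : ix i < ix (pt θ.n : Carrier.{w, v, u} θ) := h₁
    exact D.natAt_of_factor (by decide) d₁ (pointMap (pt 0))
      (D.natAt_arrowMap_of_lt' h (zeroMor h.le)) (pointMap_comp _)
  · obtain ⟨n, m⟩ := θ
    obtain rfl : n = 0 := by
      dsimp only at h₁ hi
      omega
    simp [degree] at h

theorem natAt_arrowMap (f : i ⟶ j) : D.NatAt (arrowMap f) := by
  rcases (ix_le f).lt_or_eq with hf | hf
  · exact D.natAt_arrowMap_of_lt' hf f
  · obtain rfl := ix_ext hf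
    obtain rfl := endo_eq_id f
    have d₀ : pointShape.degree ≤ 2 := by decide
    exact D.natAt_of_factor ((degree_segShape 0).trans_le (by decide)) d₀
      (arrowMap (𝟙 (pt 0 : Carrier.{w, v, u} pointShape))) (D.natAt_pointMap i)
      ((arrowMap_comp _ _).trans (congrArg (fun t : i ⟶ i => arrowMap t) (endo_eq_id _)))

theorem natAt_cellMap {f g : i ⟶ j} (η : f ⟶ g) : D.NatAt (cellMap η) := by
  by_cases e : f = g
  · subst e
    refine D.natAt_of_factor (degree_segShape 1).le ((degree_segShape 0).trans_le (by decide))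
      (cellMap (𝟙 (segMor 0))) (D.natAt_arrowMap f) ?_
    refine (cellMap_comp _ _).trans (congrArg (fun μ : f ⟶ f => cellMap μ) (Subsingleton.elim _ _))
  · refine D.natAt_cellMap_of_ne ((ix_le f).lt_of_ne fun h => e ?_) η e
    obtain rfl := ix_ext h
    exact Subsingleton.elim _ _

theorem natAt_triMap (f : i ⟶ j) (g : j ⟶ k) : D.NatAt (triMap f g) := by
  have d₁ : (segShape 0).degree ≤ 2 := (degree_segShape 0).trans_le (by decide)
  have d₃ : (triShape 0 0).degree ≤ 2 := (degree_triShape 0 0).le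
  rcases (ix_le f).lt_or_eq with hf | hf
  · rcases (ix_le g).lt_or_eq with hg | hg
    · exact D.natAt_triMap_of_lt hf hg f g
    · obtain rfl := ix_ext hg
      obtain rfl := endo_eq_id g
      exact D.natAt_of_factor d₃ d₁ (triMap (segMor 0) (𝟙 _)) (D.natAt_arrowMap f)
        (triMap_comp _ _ _)
  · obtain rfl := ix_ext hf
    obtain rfl := endo_eq_id f
    exact D.natAt_of_factor d₃ d₁ (triMap (𝟙 _) (segMor 0)) (D.natAt_arrowMap g)
      (triMap_comp _ _ _)

end NerveMap

end PastingDiagram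

namespace PastingDiagram

/-! ### Reconstruction: objects, morphisms and 2-cells -/

namespace NerveMap

variable {Q : Prop} {A B : Type u} [Bicategory.{w, v} A] [Bicategory.{w, v} B]

theorem admissible_point (hQ : Q → Strict A) (a : A) :
    Admissible Q (point.{w, v, u} Fin.elim0 a) := fun q _ _ _ p p' => by
  have := hQ q
  exact point_map_comp a p p'

theorem admissible_chain₁ (hQ : Q → Strict A) {m : Fin 1 → ℕ} {a b : A}
    (K : ((pt 0 : Carrier.{w, v, u} ⟨1, m⟩) ⟶ pt 1) ⥤ (a ⟶ b)) : Admissible Q (chain₁ K) :=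
  fun q _ _ _ p p' => by
    have := hQ q
    exact chain₁_map_comp K p p'

theorem admissible_arrow (hQ : Q → Strict A) {a b : A} (f : a ⟶ b) : Admissible Q (arrow f) :=
  admissible_chain₁ hQ _

theorem admissible_cell (hQ : Q → Strict A) {a b : A} {f g : a ⟶ b} (η : f ⟶ g) :
    Admissible Q (cell η) :=
  admissible_chain₁ hQ _

theorem admissible_cellPair (hQ : Q → Strict A) {a b : A} {f g h : a ⟶ b} (η : f ⟶ g)
    (μ : g ⟶ h) : Admissible Q (cellPair η μ) :=
  admissible_chain₁ hQ _

theorem admissible_tri (hQ : Q → Strict A) {a b c : A} (f : a ⟶ b) (g : b ⟶ c) (h : a ⟶ c)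
    (σ : h ≅ f ≫ g) (e : Q → h = f ≫ g) : Admissible Q (tri f g h σ) := fun q _ _ _ p p' => by
  have := hQ q
  exact tri_map_comp f g h σ (e q) p p'

theorem admissible_compositorTest (hQ : Q → Strict A) {a b c : A} {f : a ⟶ b} {g : b ⟶ c}
    {h : a ⟶ c} (σ : h ≅ f ≫ g) (e : Q → h = f ≫ g) : Admissible Q (compositorTest σ) := fun q _ _ _ p p' => by
  have := hQ q
  exact compositorTest_map_comp σ (e q) p p'

theorem admissible_whiskerRightTest (hQ : Q → Strict A) {a b c : A} {f f' : a ⟶ b} (η : f ⟶ f')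
    (g : b ⟶ c) : Admissible Q (whiskerRightTest η g) := fun q _ _ _ p p' => by
  have := hQ q
  exact whiskerRightTest_map_comp η g p p'

theorem admissible_whiskerLeftTest (hQ : Q → Strict A) {a b c : A} (f : a ⟶ b) {g g' : b ⟶ c}
    (η : g ⟶ g') : Admissible Q (whiskerLeftTest f η) := fun q _ _ _ p p' => by
  have := hQ q
  exact whiskerLeftTest_map_comp f η p p'

theorem admissible_chain₃ (hQ : Q → Strict A) {a b c d : A} (f : a ⟶ b) (g : b ⟶ c) (h : c ⟶ d) :
    Admissible Q (chain₃ f g h) := fun q _ _ _ p p' => by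
  have := hQ q
  exact chain₃_map_comp f g h p p'

variable (D : NerveMap Q A B) (hQ : Q → Strict A) {θ θ' : PastingDiagram}

/-- The action on objects of the normal pseudofunctor that a map of nerves comes from. -/
def obj (a : A) : B :=
  (D.app pointShape (by decide) (point Fin.elim0 a) (admissible_point hQ a)).obj (pt 0)

section

variable (hθ : θ.degree ≤ 3) (x : StrictlyUnitaryPseudofunctor (Carrier.{w, v, u} θ) A)
  (hx : Admissible Q x)

theorem app_obj (i : Carrier.{w, v, u} θ) : (D.app θ hθ x hx).obj i = D.obj hQ (x.obj i) := by
  have h := D.natAt_pointMap i (by decide) hθ x hx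
  have h' := D.app_congr (by decide) (point_comp x Fin.elim0 i) (hx.comp (pointMap i))
    (admissible_point hQ _)
  exact congrArg (fun G => G.obj (pt 0)) (h.symm.trans h')

end

theorem degree_segShape_le (m : ℕ) (h : m ≤ 2) : (segShape m).degree ≤ 3 := by
  rw [degree_segShape]
  omega

theorem degree_triShape_le (m m' : ℕ) (h : m + m' ≤ 1) : (triShape m m').degree ≤ 3 := by
  rw [degree_triShape]
  omega

/-- The cast is needed because the ends of the image arrow agree with the images of `a` and `b` only
by naturality at points. -/
def map {a b : A} (f : a ⟶ b) : D.obj hQ a ⟶ D.obj hQ b :=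
  cast (congrArg₂ Quiver.Hom
      (D.app_obj hQ (degree_segShape_le 0 (by decide)) (arrow f) (admissible_arrow hQ f) (pt 0))
      (D.app_obj hQ (degree_segShape_le 0 (by decide)) (arrow f) (admissible_arrow hQ f) (pt 1)))
    ((D.app (segShape 0) (degree_segShape_le 0 (by decide)) (arrow f)
      (admissible_arrow hQ f)).map (segMor 0))

section

variable (hθ : θ.degree ≤ 3) (x : StrictlyUnitaryPseudofunctor (Carrier.{w, v, u} θ) A)
  (hx : Admissible Q x)

theorem app_map {i j : Carrier.{w, v, u} θ} (f : i ⟶ j) :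
    HEq ((D.app θ hθ x hx).map f) (D.map hQ (x.map f)) := by
  have h := D.natAt_arrowMap f (degree_segShape_le 0 (by decide)) hθ x hx
  have h' := D.app_congr (degree_segShape_le 0 (by decide)) (arrow_comp x f)
    (hx.comp (arrowMap f)) (admissible_arrow hQ _)
  exact (StrictlyUnitaryPseudofunctor.map_heq (h.symm.trans h') (segMor 0)).trans (cast_heq _ _).symm

-- From here on these are used only through `app_obj` and `app_map`; unfolding would expose the
-- cast.
attribute [irreducible] NerveMap.obj NerveMap.map

/-- The image of an element of the nerve of `A`, with a definitional action on objects and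
morphisms. -/
def normalized : StrictlyUnitaryPseudofunctor (Carrier.{w, v, u} θ) B :=
  (D.app θ hθ x hx).copy
    { obj := fun i => D.obj hQ (x.obj i)
      map := fun f => D.map hQ (x.map f) }
    (by
      have hobj := D.app_obj hQ hθ x hx
      have hmap := fun (i j : Carrier.{w, v, u} θ) (f : i ⟶ j) => D.app_map hQ hθ x hx f
      revert hobj hmap
      generalize D.app θ hθ x hx = G
      obtain ⟨⟨⟨⟨⟨Go, Gm⟩, _⟩, _, _⟩, _, _, _, _, _, _, _⟩, _, _⟩ := G
      intro hobj hmap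
      obtain rfl : Go = _ := funext hobj
      obtain rfl : @Gm = fun i j f => D.map hQ (x.map f) := by
        funext i j f
        exact eq_of_heq (hmap i j f)
      rfl)

theorem normalized_eq : D.normalized hQ hθ x hx = D.app θ hθ x hx :=
  StrictlyUnitaryPseudofunctor.copy_eq _ _ _

theorem normalized_comp {s : StrictPseudofunctor (Carrier.{w, v, u} θ') (Carrier.{w, v, u} θ)}
    (hs : D.NatAt s) (hθ' : θ'.degree ≤ 3) {y : StrictlyUnitaryPseudofunctor (Carrier.{w, v, u} θ') A}
    (hy : Admissible Q y) (e : s.toStrictlyUnitaryPseudofunctor.comp x = y) :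
    D.normalized hQ hθ' y hy = s.toStrictlyUnitaryPseudofunctor.comp (D.normalized hQ hθ x hx) := by
  subst e
  rw [normalized_eq, normalized_eq]
  exact hs hθ' hθ x hx

end

def normalizedCell {a b : A} {f g : a ⟶ b} (η : f ⟶ g) :
    StrictlyUnitaryPseudofunctor (Carrier.{w, v, u} (segShape 1)) B :=
  D.normalized hQ (degree_segShape_le 1 (by decide)) (cell η) (admissible_cell hQ η)

def normalizedArrow {a b : A} (f : a ⟶ b) :
    StrictlyUnitaryPseudofunctor (Carrier.{w, v, u} (segShape 0)) B :=
  D.normalized hQ (degree_segShape_le 0 (by decide)) (arrow f) (admissible_arrow hQ f)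

def normalizedTri {a b c : A} (f : a ⟶ b) (g : b ⟶ c) (h : a ⟶ c) (σ : h ≅ f ≫ g)
    (e : Q → h = f ≫ g) : StrictlyUnitaryPseudofunctor (Carrier.{w, v, u} (triShape 0 0)) B :=
  D.normalized hQ (degree_triShape_le 0 0 (by decide)) (tri f g h σ) (admissible_tri hQ f g h σ e)

/-- The generating 2-cell of `[1; 1]`. -/
def segGen : segMor.{w, v, u} (0 : Fin 2) ⟶ segMor 1 := segCell (Fin.zero_le 1)

def map₂ {a b : A} {f g : a ⟶ b} (η : f ⟶ g) : D.map hQ f ⟶ D.map hQ g :=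
  (D.normalizedCell hQ η).map₂ segGen

def compositor {a b c : A} (f : a ⟶ b) (g : b ⟶ c) (h : a ⟶ c) (σ : h ≅ f ≫ g)
    (e : Q → h = f ≫ g) : D.map hQ h ≅ D.map hQ f ≫ D.map hQ g :=
  (D.normalizedTri hQ f g h σ e).mapComp (triMor01 0) (triMor12 0)

def mapComp {a b c : A} (f : a ⟶ b) (g : b ⟶ c) : D.map hQ (f ≫ g) ≅ D.map hQ f ≫ D.map hQ g :=
  D.compositor hQ f g (f ≫ g) (Iso.refl _) (fun _ => rfl)

theorem normalized_map₂ (hθ : θ.degree ≤ 3)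
    (x : StrictlyUnitaryPseudofunctor (Carrier.{w, v, u} θ) A) (hx : Admissible Q x)
    {i j : Carrier.{w, v, u} θ} {f g : i ⟶ j} (η : f ⟶ g) :
    (D.normalized hQ hθ x hx).map₂ η = D.map₂ hQ (x.map₂ η) := by
  have h : D.normalizedCell hQ (x.map₂ η) = _ :=
    D.normalized_comp hQ hθ x hx (D.natAt_cellMap η) (degree_segShape_le 1 (by decide))
      (admissible_cell hQ _) (cell_comp x η)
  have e := StrictlyUnitaryPseudofunctor.map₂_heq h segGen
  exact (eq_of_heq e).symm

theorem map_id (a : A) : D.map hQ (𝟙 a) = 𝟙 (D.obj hQ a) :=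
  (D.normalizedArrow hQ (𝟙 a)).map_id (pt 0 (Nat.zero_lt_succ _))

theorem map₂_id {a b : A} (f : a ⟶ b) : D.map₂ hQ (𝟙 f) = 𝟙 _ := by
  have e : (D.normalizedArrow hQ f).map₂ _ = _ := D.normalized_map₂ hQ _ _ _ (𝟙 (segMor 0))
  have e' : D.map₂ hQ ((arrow f).map₂ (𝟙 (segMor 0))) = D.map₂ hQ (𝟙 f) := rfl
  have h := (D.normalizedArrow hQ f).map₂_id (segMor 0)
  exact e'.symm.trans (e.symm.trans h)

/-- The pair is an element of shape `[1; 2]`, whose image preserves vertical composition. -/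
theorem map₂_comp {a b : A} {f g h : a ⟶ b} (η : f ⟶ g) (μ : g ⟶ h) :
    D.map₂ hQ (η ≫ μ) = D.map₂ hQ η ≫ D.map₂ hQ μ := by
  have h₁ : segMor.{w, v, u} (0 : Fin 3) ⟶ segMor 1 := segCell (by decide)
  have h₂ : segMor.{w, v, u} (1 : Fin 3) ⟶ segMor 2 := segCell (by decide)
  have e := (D.normalized hQ (degree_segShape_le 2 (by decide)) (cellPair η μ)
    (admissible_cellPair hQ η μ)).map₂_comp h₁ h₂
  rw [normalized_map₂, normalized_map₂, normalized_map₂] at e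
  exact e

end NerveMap

end PastingDiagram

namespace PastingDiagram

/-! ### Reconstruction: compositors and coherence -/

namespace NerveMap

variable {Q : Prop} {A B : Type u} [Bicategory.{w, v} A] [Bicategory.{w, v} B]
variable (D : NerveMap Q A B) (hQ : Q → Strict A) {θ θ' : PastingDiagram}

theorem normalized_mapComp_eq_compositor (hθ : θ.degree ≤ 3)
    (x : StrictlyUnitaryPseudofunctor (Carrier.{w, v, u} θ) A) (hx : Admissible Q x)
    {i j k : Carrier.{w, v, u} θ} (f : i ⟶ j) (g : j ⟶ k) :
    (D.normalized hQ hθ x hx).mapComp f g =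
      D.compositor hQ (x.map f) (x.map g) (x.map (f ≫ g)) (x.mapComp f g)
        (fun q => hx q f g) := by
  have e₀ : (triMap f g).toStrictlyUnitaryPseudofunctor.comp x =
      tri (x.map f) (x.map g) (x.map (f ≫ g)) (x.mapComp f g) := by
    refine (tri_comp x _ _ _ _).trans (congrArg (tri _ _ _) (Iso.ext ?_))
    change x.map₂ (𝟙 _) ≫ (x.mapComp f g).hom = _
    rw [x.map₂_id, Category.id_comp]
  have h : D.normalizedTri hQ (x.map f) (x.map g) (x.map (f ≫ g)) (x.mapComp f g)
      (fun q => hx q f g) = _ :=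
    D.normalized_comp hQ hθ x hx (D.natAt_triMap f g) (degree_triShape_le 0 0 (by decide))
      (admissible_tri hQ _ _ _ _ (fun q => hx q f g)) e₀
  have e := StrictlyUnitaryPseudofunctor.mapComp_heq h (triMor01 0) (triMor12 0)
  refine Eq.trans ?_ (eq_of_heq e).symm
  refine Iso.ext ?_
  -- The constraint of a restriction along `triMap` is the image of the constraint of `triMap`, an
  -- identity, followed by that of `G`.
  have e₁ (G : StrictlyUnitaryPseudofunctor (Carrier.{w, v, u} θ) B) :
      G.map₂ (𝟙 (f ≫ g)) ≫ (G.mapComp f g).hom = (G.mapComp f g).hom := by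
    rw [PrelaxFunctor.map₂_id, Category.id_comp]
  exact (e₁ (D.normalized hQ hθ x hx)).symm

/-- The element `compositorTest σ` of shape `[2; 1, 0]` has the triangle of `σ` at one end and that
of the identity at the other. Its 2-cell is the identity of `f`, while the composite edge moves
along `σ`; the whiskering law then compares the two compositors. -/
theorem compositor_hom {a b c : A} (f : a ⟶ b) (g : b ⟶ c) (h : a ⟶ c) (σ : h ≅ f ≫ g)
    (e : Q → h = f ≫ g) :
    (D.compositor hQ f g h σ e).hom = D.map₂ hQ σ.hom ≫ (D.mapComp hQ f g).hom := by
  let T := compositorTest σ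
  have hT : Admissible Q T := admissible_compositorTest hQ σ e
  let G := D.normalized hQ (degree_triShape_le 1 0 (by decide)) T hT
  let p₀ : (pt 0 : Carrier.{w, v, u} (triShape 1 0)) ⟶ pt 1 := triMor01 0
  let p₁ : (pt 0 : Carrier.{w, v, u} (triShape 1 0)) ⟶ pt 1 := triMor01 1
  let q : (pt 1 : Carrier.{w, v, u} (triShape 1 0)) ⟶ pt 2 := triMor12 0
  let μ : p₀ ⟶ p₁ := triCell01 (Fin.zero_le 1)
  have h₀ : G.mapComp p₀ q = D.compositor hQ f g h σ e :=
    D.normalized_mapComp_eq_compositor hQ _ T hT p₀ q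
  have h₁ : G.mapComp p₁ q = D.mapComp hQ f g :=
    D.normalized_mapComp_eq_compositor hQ _ T hT p₁ q
  have h₂ : G.map₂ μ = D.map₂ hQ (𝟙 f) := D.normalized_map₂ hQ _ T hT μ
  have h₃ : G.map₂ (μ ▷ q) = D.map₂ hQ σ.hom := D.normalized_map₂ hQ _ T hT (μ ▷ q)
  -- For a general `G` the images of `p₀` and `p₁` have to be compared by `eqToHom`; for the
  -- normalized image they agree definitionally.
  have key (G : StrictlyUnitaryPseudofunctor (Carrier.{w, v, u} (triShape 1 0)) B)
      (E : G.map p₀ = G.map p₁) (h : G.map₂ μ = eqToHom E) :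
      (G.mapComp p₀ q).hom ≫ eqToHom (by rw [E]) = G.map₂ (μ ▷ q) ≫ (G.mapComp p₁ q).hom := by
    rw [G.map₂_whisker_right, h, Bicategory.eqToHom_whiskerRight, Category.assoc, Category.assoc,
      Iso.inv_hom_id, Category.comp_id]
  have h₂' : G.map₂ μ = eqToHom rfl := h₂.trans (D.map₂_id hQ f)
  have key' := key G rfl h₂'
  rw [← h₀, ← h₁, ← h₃]
  exact (Category.comp_id _).symm.trans key'

theorem normalized_mapComp_hom (hθ : θ.degree ≤ 3)
    (x : StrictlyUnitaryPseudofunctor (Carrier.{w, v, u} θ) A) (hx : Admissible Q x)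
    {i j k : Carrier.{w, v, u} θ} (f : i ⟶ j) (g : j ⟶ k) :
    ((D.normalized hQ hθ x hx).mapComp f g).hom =
      D.map₂ hQ (x.mapComp f g).hom ≫ (D.mapComp hQ (x.map f) (x.map g)).hom := by
  rw [normalized_mapComp_eq_compositor, compositor_hom]

/-- The unit law on `[1; 0]` is used twice. In `A` it shows that the constraint `m` is inverse to
the unitor; in `B` it gives the desired identity preceded by the image of `m`, which is then
cancelled. -/
theorem map₂_left_unitor {a b : A} (f : a ⟶ b) :
    D.map₂ hQ (λ_ f).hom = (D.mapComp hQ (𝟙 a) f).hom ≫ eqToHom (by rw [map_id]) ≫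
      (λ_ (D.map hQ f)).hom := by
  have law {C : Type u} [Bicategory.{w, v} C] (G : StrictlyUnitaryPseudofunctor
      (Carrier.{w, v, u} (segShape 0)) C) {i j : Carrier.{w, v, u} (segShape 0)} (p : i ⟶ j) :
      G.map₂ (λ_ p).hom = (G.mapComp (𝟙 i) p).hom ≫ eqToHom (by rw [G.map_id]) ≫
        (λ_ (G.map p)).hom := by
    rw [G.map₂_left_unitor, G.mapId_eq_eqToIso, eqToIso.hom, Bicategory.eqToHom_whiskerRight]
  let i₀ : Carrier.{w, v, u} (segShape 0) := pt 0
  let i₁ : Carrier.{w, v, u} (segShape 0) := pt 1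
  let p : i₀ ⟶ i₁ := segMor 0
  let m : f ⟶ 𝟙 a ≫ f := ((arrow f).mapComp (𝟙 i₀) p).hom
  have hm : 𝟙 f = m ≫ (λ_ f).hom :=
    (law (arrow f) p).trans (congrArg (m ≫ ·) (Category.id_comp (λ_ f).hom))
  have e : D.map₂ hQ (𝟙 f) = (D.normalizedArrow hQ f).map₂ (λ_ p).hom :=
    (D.normalized_map₂ hQ (degree_segShape_le 0 (by decide)) (arrow f)
      (admissible_arrow hQ f) (λ_ p).hom).symm
  have e' : ((D.normalizedArrow hQ f).mapComp (𝟙 i₀) p).hom =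
      D.map₂ hQ m ≫ (D.mapComp hQ (𝟙 a) f).hom :=
    D.normalized_mapComp_hom hQ (degree_segShape_le 0 (by decide)) (arrow f)
      (admissible_arrow hQ f) (𝟙 i₀) p
  have key : D.map₂ hQ (𝟙 f) = D.map₂ hQ m ≫ (D.mapComp hQ (𝟙 a) f).hom ≫
      eqToHom (by rw [map_id]) ≫ (λ_ (D.map hQ f)).hom :=
    (e.trans (law (D.normalizedArrow hQ f) p)).trans
      ((congrArg (· ≫ _) e').trans (Category.assoc _ _ _))
  have hm' : (λ_ f).hom ≫ m = 𝟙 _ := by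
    rw [← cancel_mono (λ_ f).hom, Category.assoc, ← hm, Category.comp_id, Category.id_comp]
  rw [← Category.comp_id (D.map₂ hQ (λ_ f).hom), ← D.map₂_id, key, ← Category.assoc,
    ← map₂_comp, hm', map₂_id, Category.id_comp]

theorem map₂_right_unitor {a b : A} (f : a ⟶ b) :
    D.map₂ hQ (ρ_ f).hom = (D.mapComp hQ f (𝟙 b)).hom ≫ eqToHom (by rw [map_id]) ≫
      (ρ_ (D.map hQ f)).hom := by
  have law {C : Type u} [Bicategory.{w, v} C] (G : StrictlyUnitaryPseudofunctor
      (Carrier.{w, v, u} (segShape 0)) C) {i j : Carrier.{w, v, u} (segShape 0)} (p : i ⟶ j) :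
      G.map₂ (ρ_ p).hom = (G.mapComp p (𝟙 j)).hom ≫ eqToHom (by rw [G.map_id]) ≫
        (ρ_ (G.map p)).hom := by
    rw [G.map₂_right_unitor, G.mapId_eq_eqToIso, eqToIso.hom, Bicategory.whiskerLeft_eqToHom]
  let i₀ : Carrier.{w, v, u} (segShape 0) := pt 0
  let i₁ : Carrier.{w, v, u} (segShape 0) := pt 1
  let p : i₀ ⟶ i₁ := segMor 0
  let m : f ⟶ f ≫ 𝟙 b := ((arrow f).mapComp p (𝟙 i₁)).hom
  have hm : 𝟙 f = m ≫ (ρ_ f).hom :=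
    (law (arrow f) p).trans (congrArg (m ≫ ·) (Category.id_comp (ρ_ f).hom))
  have e : D.map₂ hQ (𝟙 f) = (D.normalizedArrow hQ f).map₂ (ρ_ p).hom :=
    (D.normalized_map₂ hQ (degree_segShape_le 0 (by decide)) (arrow f)
      (admissible_arrow hQ f) (ρ_ p).hom).symm
  have e' : ((D.normalizedArrow hQ f).mapComp p (𝟙 i₁)).hom =
      D.map₂ hQ m ≫ (D.mapComp hQ f (𝟙 b)).hom :=
    D.normalized_mapComp_hom hQ (degree_segShape_le 0 (by decide)) (arrow f)
      (admissible_arrow hQ f) p (𝟙 i₁)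
  have key : D.map₂ hQ (𝟙 f) = D.map₂ hQ m ≫ (D.mapComp hQ f (𝟙 b)).hom ≫
      eqToHom (by rw [map_id]) ≫ (ρ_ (D.map hQ f)).hom :=
    (e.trans (law (D.normalizedArrow hQ f) p)).trans
      ((congrArg (· ≫ _) e').trans (Category.assoc _ _ _))
  have hm' : (ρ_ f).hom ≫ m = 𝟙 _ := by
    rw [← cancel_mono (ρ_ f).hom, Category.assoc, ← hm, Category.comp_id, Category.id_comp]
  rw [← Category.comp_id (D.map₂ hQ (ρ_ f).hom), ← D.map₂_id, key, ← Category.assoc,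
    ← map₂_comp, hm', map₂_id, Category.id_comp]

/-- In the associativity law for the image of `chain₃ f g h`, the left side is an identity, since
`chain₃` sends every 2-cell to one, and three of the constraints are plain compositors. The fourth,
at `0, 1, 3`, carries the image of the associator, for which the law is solved. -/
theorem map₂_associator {a b c d : A} (f : a ⟶ b) (g : b ⟶ c) (h : c ⟶ d) :
    D.map₂ hQ (α_ f g h).hom = (D.mapComp hQ (f ≫ g) h).hom ≫
      (D.mapComp hQ f g).hom ▷ D.map hQ h ≫ (α_ (D.map hQ f) (D.map hQ g) (D.map hQ h)).hom ≫
        D.map hQ f ◁ (D.mapComp hQ g h).inv ≫ (D.mapComp hQ f (g ≫ h)).inv := by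
  let p : (pt 0 : Carrier.{w, v, u} tetShape) ⟶ pt 1 := zeroMor (Fin.zero_le _)
  let q : (pt 1 : Carrier.{w, v, u} tetShape) ⟶ pt 2 := zeroMor (Fin.le_def.2 (Nat.le_succ 1))
  let r : (pt 2 : Carrier.{w, v, u} tetShape) ⟶ pt 3 := zeroMor (Fin.le_def.2 (Nat.le_succ 2))
  let G := D.normalized hQ degree_tetShape.le (chain₃ f g h) (admissible_chain₃ hQ f g h)
  have h₀ : G.mapComp (p ≫ q) r = D.mapComp hQ (f ≫ g) h :=
    D.normalized_mapComp_eq_compositor hQ degree_tetShape.le (chain₃ f g h)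
      (admissible_chain₃ hQ f g h) (p ≫ q) r
  have h₁ : G.mapComp p q = D.mapComp hQ f g :=
    D.normalized_mapComp_eq_compositor hQ degree_tetShape.le (chain₃ f g h)
      (admissible_chain₃ hQ f g h) p q
  have h₂ : G.mapComp q r = D.mapComp hQ g h :=
    D.normalized_mapComp_eq_compositor hQ degree_tetShape.le (chain₃ f g h)
      (admissible_chain₃ hQ f g h) q r
  have h₃ : (G.mapComp p (q ≫ r)).hom = D.map₂ hQ (α_ f g h).hom ≫ (D.mapComp hQ f (g ≫ h)).hom :=
    D.normalized_mapComp_hom hQ degree_tetShape.le (chain₃ f g h)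
      (admissible_chain₃ hQ f g h) p (q ≫ r)
  have h₄ : G.map₂ (α_ p q r).hom = 𝟙 (D.map hQ ((f ≫ g) ≫ h)) :=
    (D.normalized_map₂ hQ degree_tetShape.le (chain₃ f g h)
      (admissible_chain₃ hQ f g h) (α_ p q r).hom).trans (D.map₂_id hQ _)
  have law := G.map₂_associator p q r
  let c : D.map hQ ((f ≫ g) ≫ h) ≅ D.map hQ f ≫ D.map hQ (g ≫ h) := G.mapComp p (q ≫ r)
  have law' : 𝟙 (D.map hQ ((f ≫ g) ≫ h)) = (D.mapComp hQ (f ≫ g) h).hom ≫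
      (D.mapComp hQ f g).hom ▷ D.map hQ h ≫ (α_ (D.map hQ f) (D.map hQ g) (D.map hQ h)).hom ≫
        D.map hQ f ◁ (D.mapComp hQ g h).inv ≫ c.inv := by
    rw [← h₀, ← h₁, ← h₂]
    exact h₄.symm.trans law
  have h₅ : c.hom = D.map₂ hQ (α_ f g h).hom ≫ (D.mapComp hQ f (g ≫ h)).hom := h₃
  rw [← cancel_mono (D.mapComp hQ f (g ≫ h)).hom, ← h₅, ← Category.id_comp c.hom, law']
  simp only [Category.assoc, Iso.inv_hom_id, Category.comp_id]

/-- The normal pseudofunctor that a map of nerves comes from. -/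
def toPseudofunctor : StrictlyUnitaryPseudofunctor A B :=
  StrictlyUnitaryPseudofunctor.mk'
    { obj := D.obj hQ
      map := D.map hQ
      map_id := D.map_id hQ
      map₂ := D.map₂ hQ
      map₂_id := D.map₂_id hQ
      map₂_comp := D.map₂_comp hQ
      mapComp := D.mapComp hQ
      -- The test element has identity constraints, so those of its image are exactly the
      -- compositors, and its law is the required one.
      map₂_whisker_left := fun {a b c} f {g h} η => by
        let hx := admissible_whiskerLeftTest hQ f η
        let G := D.normalized hQ (degree_triShape_le 0 1 (by decide)) _ hx
        let q : (pt 0 : Carrier.{w, v, u} (triShape 0 1)) ⟶ pt 1 := triMor01 0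
        let p₀ : (pt 1 : Carrier.{w, v, u} (triShape 0 1)) ⟶ pt 2 := triMor12 0
        let p₁ : (pt 1 : Carrier.{w, v, u} (triShape 0 1)) ⟶ pt 2 := triMor12 1
        let μ : p₀ ⟶ p₁ := triCell12 (Fin.zero_le 1)
        have h₀ : G.mapComp q p₀ = D.mapComp hQ f g :=
          D.normalized_mapComp_eq_compositor hQ _ _ hx q p₀
        have h₁ : G.mapComp q p₁ = D.mapComp hQ f h :=
          D.normalized_mapComp_eq_compositor hQ _ _ hx q p₁
        have h₂ : G.map₂ μ = D.map₂ hQ η := D.normalized_map₂ hQ _ _ hx μ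
        have h₃ : G.map₂ (q ◁ μ) = D.map₂ hQ (f ◁ η) := D.normalized_map₂ hQ _ _ hx (q ◁ μ)
        rw [← h₀, ← h₁, ← h₂, ← h₃]
        exact G.map₂_whisker_left q μ
      map₂_whisker_right := fun {a b c f f'} η g => by
        let hx := admissible_whiskerRightTest hQ η g
        let G := D.normalized hQ (degree_triShape_le 1 0 (by decide)) _ hx
        let p₀ : (pt 0 : Carrier.{w, v, u} (triShape 1 0)) ⟶ pt 1 := triMor01 0
        let p₁ : (pt 0 : Carrier.{w, v, u} (triShape 1 0)) ⟶ pt 1 := triMor01 1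
        let q : (pt 1 : Carrier.{w, v, u} (triShape 1 0)) ⟶ pt 2 := triMor12 0
        let μ : p₀ ⟶ p₁ := triCell01 (Fin.zero_le 1)
        have h₀ : G.mapComp p₀ q = D.mapComp hQ f g :=
          D.normalized_mapComp_eq_compositor hQ _ _ hx p₀ q
        have h₁ : G.mapComp p₁ q = D.mapComp hQ f' g :=
          D.normalized_mapComp_eq_compositor hQ _ _ hx p₁ q
        have h₂ : G.map₂ μ = D.map₂ hQ η := D.normalized_map₂ hQ _ _ hx μ
        have h₃ : G.map₂ (μ ▷ q) = D.map₂ hQ (η ▷ g) := D.normalized_map₂ hQ _ _ hx (μ ▷ q)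
        rw [← h₀, ← h₁, ← h₂, ← h₃]
        exact G.map₂_whisker_right μ q
      map₂_left_unitor := D.map₂_left_unitor hQ
      map₂_right_unitor := D.map₂_right_unitor hQ
      map₂_associator := D.map₂_associator hQ }

theorem app_eq (hθ : θ.degree ≤ 3)
    (x : StrictlyUnitaryPseudofunctor (Carrier.{w, v, u} θ) A) (hx : Admissible Q x) :
    D.app θ hθ x hx = x.comp (D.toPseudofunctor hQ) := by
  rw [← D.normalized_eq hQ hθ x hx]
  refine normalPseudofunctor_ext_heq (fun _ => rfl) (fun _ => HEq.rfl) ?_ ?_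
  · intro i j f g η
    exact heq_of_eq (D.normalized_map₂ hQ hθ x hx η)
  · intro i j k f g
    exact heq_of_eq (Iso.ext (D.normalized_mapComp_hom hQ hθ x hx f g))

/-- Normal pseudofunctors are equal if they agree on the admissible elements of the nerve of degree
at most two. -/
theorem ext_of_comp_eq (hQ : Q → Strict A) {F F' : StrictlyUnitaryPseudofunctor A B}
    (h : ∀ (θ : PastingDiagram) (_ : θ.degree ≤ 2)
      (x : StrictlyUnitaryPseudofunctor (Carrier.{w, v, u} θ) A) (_ : Admissible Q x),
      x.comp F = x.comp F') : F = F' := by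
  refine normalPseudofunctor_ext_heq ?_ ?_ ?_ ?_
  · intro a
    exact congrArg (fun G => G.obj (pt 0))
      (h pointShape (by decide) (point Fin.elim0 a) (admissible_point hQ a))
  · intro a b f
    exact StrictlyUnitaryPseudofunctor.map_heq
      (h (segShape 0) ((degree_segShape 0).trans_le (by decide)) (arrow f) (admissible_arrow hQ f))
      (segMor 0)
  · intro a b f g η
    exact StrictlyUnitaryPseudofunctor.map₂_heq
      (h (segShape 1) (degree_segShape 1).le (cell η) (admissible_cell hQ η)) segGen
  · intro a b c f g
    have key (F : StrictlyUnitaryPseudofunctor A B) : (tri f g (f ≫ g) (Iso.refl _)).comp F =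
        tri (F.map f) (F.map g) (F.map (f ≫ g)) (F.mapComp f g) := by
      refine (tri_comp F _ _ _ _).trans (congrArg (tri _ _ _) (Iso.ext ?_))
      change F.map₂ (𝟙 _) ≫ (F.mapComp f g).hom = _
      rw [F.map₂_id, Category.id_comp]
    exact StrictlyUnitaryPseudofunctor.mapComp_heq
      ((key F).symm.trans ((h (triShape 0 0) (degree_triShape 0 0).le _
        (admissible_tri hQ f g _ _ fun _ => rfl)).trans (key F'))) (triMor01 0) (triMor12 0)

end NerveMap

end PastingDiagram

/-! ### Full faithfulness of the truncated nerve -/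

namespace PastingDiagram

variable {θ θ' : PastingDiagram}

/-- An object of `Θ₂`. -/
abbrev theta (θ : PastingDiagram) : Theta₂.{w, v, u} := θ

/-- A 2-functor, as a morphism of `Θ₂`. -/
def thetaHom (s : StrictPseudofunctor (Carrier.{w, v, u} θ) (Carrier.{w, v, u} θ')) :
    theta.{w, v, u} θ ⟶ theta θ' :=
  InducedCategory.homMk s

theorem IsInjective.map_heq {A B : Type u} [Bicategory.{w, v} A] [Bicategory.{w, v} B]
    {s : StrictPseudofunctor A B} (hs : IsInjective s) {a b a' b' : A} (ha : a = a') (hb : b = b')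
    {f : a ⟶ b} {f' : a' ⟶ b'} (h : HEq (s.map f) (s.map f')) : HEq f f' := by
  subst ha hb
  exact heq_of_eq (hs.map (eq_of_heq h))

/-- Injectivity on 2-cells need not be assumed: a 2-functor into a pasting 2-category is determined
by objects and morphisms. -/
theorem IsInjective.mono {s : StrictPseudofunctor (Carrier.{w, v, u} θ) (Carrier.{w, v, u} θ')}
    (hs : IsInjective s) : Mono (thetaHom s) where
  right_cancellation {z} g h e := by
    have hobj (a) : g.hom.obj a = h.hom.obj a := hs.obj (congrArg (fun t => t.hom.obj a) e)
    exact InducedCategory.hom_ext (strictPseudofunctor_ext_carrier hobj fun {a b} f =>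
      hs.map_heq (hobj a) (hobj b) (StrictlyUnitaryPseudofunctor.map_heq
        (congrArg (fun t => t.hom.toStrictlyUnitaryPseudofunctor) e) f))

/-- An object of `Θ_b`. -/
def thetaB (θ : PastingDiagram) (hθ : θ.degree ≤ 3) : ThetaB.{w, v, u} := ⟨⟨θ, hθ⟩⟩

def thetaBHom (hθ : θ.degree ≤ 3) (hθ' : θ'.degree ≤ 3)
    (s : StrictPseudofunctor (Carrier.{w, v, u} θ) (Carrier.{w, v, u} θ'))
    (h : (θ.degree ≤ 2 ∧ θ'.degree ≤ 2) ∨ (θ.degree = 2 ∧ θ'.degree = 3 ∧ IsInjective s)) :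
    thetaB.{w, v, u} θ hθ ⟶ thetaB θ' hθ' :=
  ⟨ObjectProperty.homMk (thetaHom s), .of _ (h.imp id fun h => ⟨h.1, h.2.1, h.2.2.mono⟩)⟩

section

variable {A B : Bicat.{w, v, u}}

/-- The map of nerves given by a morphism of truncated nerves. -/
def nerveMap (α : truncatedNerve.obj A ⟶ truncatedNerve.obj B) :
    NerveMap False A.carrier B.carrier where
  app θ hθ x _ := α.app (op (thetaB θ hθ)) x
  nat_low hθ hθ' h h' s x _ :=
    NatTrans.naturality_apply α (thetaBHom hθ hθ' s (.inl ⟨h, h'⟩)).op x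
  nat_mono hθ hθ' h h' s hs x _ :=
    NatTrans.naturality_apply α (thetaBHom hθ hθ' s (.inr ⟨h, h', hs⟩)).op x

theorem truncatedNerve_full : truncatedNerve.{w, v, u}.Full where
  map_surjective {A B} α := by
    -- With `Q` false every element is admissible and no strictness of `A` is required.
    refine ⟨(nerveMap α).toPseudofunctor False.elim, ?_⟩
    ext b x
    exact ((nerveMap α).app_eq False.elim b.unop.obj.property x (fun h => h.elim)).symm

theorem truncatedNerve_faithful : truncatedNerve.{w, v, u}.Faithful where
  map_injective {A B F G} h := by
    refine NerveMap.ext_of_comp_eq (Q := False) False.elim fun θ hθ x _ => ?_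
    exact congrArg (fun α => α.app (op (thetaB θ (hθ.trans (by decide)))) x) h

end

/-! ### The coherent nerve as a right Kan extension -/

section

variable {B : Bicat.{w, v, u}} {G : Theta₂.{w, v, u}ᵒᵖ ⥤ Type (max w v u)}
  (β : ThetaB.incl.op ⋙ G ⟶ truncatedNerve.obj B)

instance (θ : PastingDiagram) : Strict (Carrier.{w, v, u} θ) :=
  (twoCat.{w, v, u} θ).strict

theorem map_thetaHom_comp {θ ρ ρ' : PastingDiagram} (g : G.obj (op (theta.{w, v, u} θ)))
    (s : StrictPseudofunctor (Carrier.{w, v, u} ρ) (Carrier.{w, v, u} ρ'))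
    (t : StrictPseudofunctor (Carrier.{w, v, u} ρ') (Carrier.{w, v, u} θ)) :
    G.map (thetaHom (s.comp t)).op g = G.map (thetaHom s).op (G.map (thetaHom t).op g) :=
  Functor.map_comp_apply G (thetaHom t).op (thetaHom s).op g

theorem app_map_thetaHom {ρ ρ' : PastingDiagram} (hρ : ρ.degree ≤ 3) (hρ' : ρ'.degree ≤ 3)
    (s : StrictPseudofunctor (Carrier.{w, v, u} ρ) (Carrier.{w, v, u} ρ'))
    (h : (ρ.degree ≤ 2 ∧ ρ'.degree ≤ 2) ∨ (ρ.degree = 2 ∧ ρ'.degree = 3 ∧ IsInjective s))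
    (y : G.obj (op (theta.{w, v, u} ρ'))) :
    β.app (op (thetaB ρ hρ)) (G.map (thetaHom s).op y) =
      s.toStrictlyUnitaryPseudofunctor.comp (β.app (op (thetaB ρ' hρ')) y) :=
  NatTrans.naturality_apply β (thetaBHom hρ hρ' s h).op y

/-- The map of nerves from the representable presheaf of `θ` given by an element of a presheaf and
a natural transformation from its restriction to the truncated nerve. -/
def elementMap {θ : PastingDiagram} (g : G.obj (op (theta.{w, v, u} θ))) :
    NerveMap True (Carrier.{w, v, u} θ) B.carrier where
  app ρ hρ x hx := β.app (op (thetaB ρ hρ)) (G.map (thetaHom (toStrict x (hx trivial))).op g)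
  nat_low hρ hρ' h h' s x hx :=
    (congrArg (β.app (op (thetaB _ hρ)))
      (map_thetaHom_comp g s (toStrict x (hx trivial)))).trans
      (app_map_thetaHom β hρ hρ' s (.inl ⟨h, h'⟩) _)
  nat_mono hρ hρ' h h' s hs x hx :=
    (congrArg (β.app (op (thetaB _ hρ)))
      (map_thetaHom_comp g s (toStrict x (hx trivial)))).trans
      (app_map_thetaHom β hρ hρ' s (.inr ⟨h, h', hs⟩) _)

/-- The normal pseudofunctor given by an element of a presheaf and a natural transformation from
its restriction to the truncated nerve. -/
def elementPseudofunctor {θ : PastingDiagram} (g : G.obj (op (theta.{w, v, u} θ))) :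
    StrictlyUnitaryPseudofunctor (Carrier.{w, v, u} θ) B.carrier :=
  (elementMap β g).toPseudofunctor fun _ => inferInstance

theorem comp_elementPseudofunctor {θ ρ : PastingDiagram}
    (g : G.obj (op (theta.{w, v, u} θ))) (hρ : ρ.degree ≤ 3)
    (s : StrictPseudofunctor (Carrier.{w, v, u} ρ) (Carrier.{w, v, u} θ)) :
    s.toStrictlyUnitaryPseudofunctor.comp (elementPseudofunctor β g) =
      β.app (op (thetaB ρ hρ)) (G.map (thetaHom s).op g) :=
  ((elementMap β g).app_eq (fun _ => inferInstance) hρ s.toStrictlyUnitaryPseudofunctor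
    (fun _ _ _ _ f f' => s.map_comp f f')).symm

/-- The nerve is separated with respect to restriction along 2-functors from shapes of degree at
most three: since `θ` is strict, all test elements of `θ` are 2-functors. -/
theorem ext_of_strict_comp_eq {θ : PastingDiagram}
    {F F' : StrictlyUnitaryPseudofunctor (Carrier.{w, v, u} θ) B.carrier}
    (h : ∀ (ρ : PastingDiagram) (_ : ρ.degree ≤ 3)
      (s : StrictPseudofunctor (Carrier.{w, v, u} ρ) (Carrier.{w, v, u} θ)),
      s.toStrictlyUnitaryPseudofunctor.comp F = s.toStrictlyUnitaryPseudofunctor.comp F') :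
    F = F' :=
  NerveMap.ext_of_comp_eq (Q := True) (fun _ => inferInstance) fun ρ hρ x hx =>
    h ρ (hρ.trans (by decide)) (toStrict x (hx trivial))

/-- The extension of a natural transformation to the truncated nerve. -/
def nerveLift : G ⟶ coherentNerve.obj B where
  app X := ↾fun g => elementPseudofunctor β g
  naturality X Y t := by
    ext g
    -- Restricted along `s`, both sides become the value of `β` at the restriction of `g` along `s`
    -- followed by `t`.
    refine ext_of_strict_comp_eq fun ρ hρ s => ?_
    refine (comp_elementPseudofunctor β _ hρ s).trans ?_
    refine (congrArg (β.app (op (thetaB ρ hρ)))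
      (map_thetaHom_comp g s t.unop.hom).symm).trans ?_
    refine (comp_elementPseudofunctor β g hρ (s.comp t.unop.hom)).symm.trans ?_
    exact Category.assoc (W := Bicat.mk (Carrier.{w, v, u} ρ))
      (X := Bicat.mk (Carrier.{w, v, u} Y.unop)) (Y := Bicat.mk (Carrier.{w, v, u} X.unop)) (Z := B)
      s.toStrictlyUnitaryPseudofunctor t.unop.hom.toStrictlyUnitaryPseudofunctor
      (elementPseudofunctor β g)

/-- On a shape of degree at most three the defining property of the lift can be evaluated at the
identity 2-functor. -/
theorem nerveLift_fac : Functor.whiskerLeft ThetaB.incl.op (nerveLift β) = β := by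
  ext b g
  have e := comp_elementPseudofunctor β g b.unop.obj.property (StrictPseudofunctor.id _)
  have e' : G.map (thetaHom (StrictPseudofunctor.id (Carrier.{w, v, u} b.unop.obj.obj))).op g = g :=
    Functor.map_id_apply G _ g
  refine Eq.trans ?_ (e.trans (congrArg (β.app b) e'))
  exact (Category.id_comp (X := Bicat.mk (Carrier.{w, v, u} b.unop.obj.obj)) (Y := B)
    (elementPseudofunctor β g)).symm

theorem hom_ext_of_whiskerLeft_eq {α α' : G ⟶ coherentNerve.obj B}
    (h : Functor.whiskerLeft ThetaB.incl.op α = Functor.whiskerLeft ThetaB.incl.op α') :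
    α = α' := by
  ext X g
  refine ext_of_strict_comp_eq fun ρ hρ s => ?_
  have e := congrArg (fun γ => γ.app (op (thetaB ρ hρ)) (G.map (thetaHom s).op g)) h
  exact (NatTrans.naturality_apply α (thetaHom s).op g).symm.trans
    (e.trans (NatTrans.naturality_apply α' (thetaHom s).op g))

end

/-- The universal property with identity counit: `nerveLift` gives existence, separatedness gives
uniqueness. -/
instance coherentNerve_isRightKanExtension (B : Bicat.{w, v, u}) :
    (coherentNerve.obj B).IsRightKanExtension
      (𝟙 (ThetaB.incl.{w, v, u}.op ⋙ coherentNerve.obj B)) where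
  nonempty_isUniversal := ⟨Limits.IsTerminal.ofUniqueHom
    (fun E => CostructuredArrow.homMk (nerveLift E.hom)
      ((Category.comp_id _).trans (nerveLift_fac E.hom)))
    (fun E m => CostructuredArrow.hom_ext _ _ (hom_ext_of_whiskerLeft_eq
      (((Category.comp_id _).symm.trans (CostructuredArrow.w m)).trans (nerveLift_fac E.hom).symm)))⟩

/-- Restricting the coherent nerve to `Θ_b` gives the truncated nerve on the nose, and the latter is
faithful. -/
theorem coherentNerve_faithful : coherentNerve.{w, v, u}.Faithful where
  map_injective {A B F G} h := by
    have := truncatedNerve_faithful.{w, v, u}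
    exact truncatedNerve.map_injective (congrArg (Functor.whiskerLeft ThetaB.incl.op) h)

theorem coherentNerve_full : coherentNerve.{w, v, u}.Full where
  map_surjective {A B} α := by
    have := truncatedNerve_full.{w, v, u}
    obtain ⟨F, hF⟩ := truncatedNerve.map_surjective
      (show truncatedNerve.obj A ⟶ truncatedNerve.obj B from Functor.whiskerLeft ThetaB.incl.op α)
    exact ⟨F, hom_ext_of_whiskerLeft_eq hF⟩

/-- The coherent nerve is the right Kan extension of the truncated coherent nerve. -/
noncomputable def coherentNerveIso :
    coherentNerve.{w, v, u} ≅ truncatedNerve.{w, v, u} ⋙ ThetaB.incl.{w, v, u}.op.ran :=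
  have : IsIso (Functor.whiskerLeft coherentNerve.{w, v, u}
      (ThetaB.incl.{w, v, u}.op.ranAdjunction (Type (max w v u))).unit) := by
    rw [NatTrans.isIso_iff_isIso_app]
    -- The unit of the adjunction is invertible at a presheaf exactly when that presheaf is the
    -- right Kan extension of its restriction.
    exact fun B => (Functor.isIso_ranAdjunction_unit_app_iff _ _).2 inferInstance
  asIso (Functor.whiskerLeft coherentNerve.{w, v, u}
    (ThetaB.incl.{w, v, u}.op.ranAdjunction (Type (max w v u))).unit)

end PastingDiagram

theorem theorem3 :
    (coherentNerve.{w, v, u}.Full ∧ coherentNerve.{w, v, u}.Faithful) ∧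
    (truncatedNerve.{w, v, u}.Full ∧ truncatedNerve.{w, v, u}.Faithful) ∧
    Nonempty (coherentNerve.{w, v, u} ≅ truncatedNerve.{w, v, u} ⋙ ThetaB.incl.{w, v, u}.op.ran) :=
  ⟨⟨PastingDiagram.coherentNerve_full, PastingDiagram.coherentNerve_faithful⟩,
    ⟨PastingDiagram.truncatedNerve_full, PastingDiagram.truncatedNerve_faithful⟩,
    ⟨PastingDiagram.coherentNerveIso⟩⟩
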